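/- Let $G$ be a finite multigraph with vertex set $V$ and edge set $E$ (loops and parallel edges are allowed) and a fixed arbitrary orientation of its edges, and identify each edge $e_j$, in the direction of its orientation, with $[0,1]$. For every edge $e_j$ let $q_j\in L^1(0,1)$ be a (real- or complex-valued) potential, and for $\lambda\in\mathbb C$ let $c_j(x,\lambda)$ and $s_j(x,\lambda)$ be the solutions of $-y''+q_jy=\lambda y$ on $[0,1]$ with $c_j(0,\lambda)=1$, $c_j'(0,\lambda)=0$ and $s_j(0,\lambda)=0$, $s_j'(0,\lambda)=1$. Let $\sqrt\lambda$ denote the principal square root. The spectral determinant is the determinant of the $(|V|+|E|)\times(|V|+|E|)$ matrix $$M=M(\lambda)=\begin{bmatrix}A&B\\ C&D\end{bmatrix},$$ where - $A$ is the $V\times V$ matrix with $a_{vu}=\frac1{\sqrt\lambda}\sum c_j'(1,\lambda)$, the sum over all edges $e_j$ pointing from $u$ to $v$; - $B$ is the $V\times E$ matrix with $b_{vj}=s_j'(1,\lambda)$ if $e_j$ ends in $v$, $b_{vj}=-1$ if $e_j$ starts from $v$, $b_{vj}=s_j'(1,\lambda)-1$ if $e_j$ is a loop at $v$, and $b_{vj}=0$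 otherwise; - $C$ is the $E\times V$ matrix with $c_{jv}=-1$ if $e_j$ ends in $v$, $c_{jv}=c_j(1,\lambda)$ if $e_j$ starts from $v$, $c_{jv}=-1+c_j(1,\lambda)$ if $e_j$ is a loop at $v$, and $c_{jv}=0$ otherwise; - $D$ is the diagonal $E\times E$ matrix with $d_{jj}=\sqrt\lambda\,s_j(1,\lambda)$. An odd saturated forest of $G$ is a spanning subgraph $\tau$ (all the vertices of $G$ and a subset of its edges) such that every connected component of $\tau$ contains exactly one cycle, and every cycle of $\tau$ has odd length; here a loop is a cycle of length $1$ and two parallel edges form a cycle of length $2$. Let $\kappa(\tau)$ be the number of connected components of $\tau$. Then, if $\lambda=(2k+1)^2\pi^2+O(1)$ as $k\to\infty$ ($k\in\mathbb N$), $$\det M=(-1)^{|V|}\sum_{\tau}4^{\kappa(\tau)}\prod_{e_j\notin\tau}\sqrt{\lambda}\,s_j(1,\lambda)+o\!\left(|\lambda|^{-\frac{|E|-|V|+1}{2}}\right),$$ where the sum is over all odd saturated forests $\tau$ of $G$. The error is uniform for $\lambda$ in the discs $|\lambda-(2k+1)^2\pi^2|\le K$, for each fixed $K$. -/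

import Mathlib

open MeasureTheory Set Filter Topology Asymptotics

/-- `y` (with derivative `y'`) solves `-y'' + q y = lam y` on `[0, 1]` in the usual sense for an
integrable potential: `y` is differentiable on `[0, 1]` with derivative `y'`, the function `y'` is
absolutely continuous on `[0, 1]`, and the equation holds almost everywhere. -/
structure IsSchrodingerSolution (q : ℝ → ℂ) (lam : ℂ) (y y' : ℝ → ℂ) : Prop where
  hasDeriv : ∀ x ∈ Icc (0 : ℝ) 1, HasDerivWithinAt y (y' x) (Icc 0 1) x
  absCont : AbsolutelyContinuousOnInterval y' 0 1
  equation : ∀ᵐ x ∂volume.restrict (Ioo (0 : ℝ) 1),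
    ∃ y'' : ℂ, HasDerivAt y' y'' x ∧ -y'' + q x * y x = lam * y x

/-- Primitives of integrable complex functions are absolutely continuous. -/
theorem absCont_complex {f : ℝ → ℂ} (hf : Integrable f) :
    AbsolutelyContinuousOnInterval (fun x => ∫ t in (0 : ℝ)..x, f t) 0 1 := by
  have hre := (hf.re.intervalIntegrable (a := 0) (b := 1)).absolutelyContinuousOnInterval_intervalIntegral
    (c := 0) (by simp)
  have him := (hf.im.intervalIntegrable (a := 0) (b := 1)).absolutelyContinuousOnInterval_intervalIntegral
    (c := 0) (by simp)
  refine squeeze_zero (fun t ↦ Finset.sum_nonneg (fun i hi ↦ dist_nonneg)) (fun t ↦ ?_)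
    (by simpa using Tendsto.add hre him)
  rw [← Finset.sum_add_distrib]
  refine Finset.sum_le_sum fun i _ => ?_
  have hI : ∀ x : ℝ, IntervalIntegrable f volume 0 x := fun x => hf.intervalIntegrable
  have h1 : ∀ x : ℝ, (∫ t in (0 : ℝ)..x, f t).re = ∫ t in (0 : ℝ)..x, (f t).re := fun x =>
    (Complex.reCLM.intervalIntegral_comp_comm (hI x)).symm
  have h2 : ∀ x : ℝ, (∫ t in (0 : ℝ)..x, f t).im = ∫ t in (0 : ℝ)..x, (f t).im := fun x =>
    (Complex.imCLM.intervalIntegral_comp_comm (hI x)).symm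
  rw [Complex.dist_eq, ← h1, ← h1, ← h2, ← h2, Real.dist_eq, Real.dist_eq, ← Complex.sub_re,
    ← Complex.sub_im]
  exact Complex.norm_le_abs_re_add_abs_im _

/-- An integral bound for exponential weights. -/
theorem integral_mul_exp_le {g : ℝ → ℝ} (hg : Integrable g) (x : ℝ) :
    ∫ t in (0 : ℝ)..x, g t * Real.exp (2 * ∫ s in (0 : ℝ)..t, g s) ≤
      Real.exp (2 * ∫ s in (0 : ℝ)..x, g s) / 2 := by
  set P : ℝ → ℝ := fun t => ∫ s in (0 : ℝ)..t, g s with hP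
  have hAC : AbsolutelyContinuousOnInterval P 0 x :=
    (hg.intervalIntegrable).absolutelyContinuousOnInterval_intervalIntegral (by simp)
  obtain ⟨C, hC⟩ := hAC.exists_bound
  have hE : AbsolutelyContinuousOnInterval (fun t => Real.exp (2 * P t)) 0 x := by
    unfold AbsolutelyContinuousOnInterval at hAC ⊢
    refine squeeze_zero' (Eventually.of_forall fun t ↦ Finset.sum_nonneg (fun i hi ↦ dist_nonneg)) ?_
      (by simpa using hAC.const_mul (2 * Real.exp (2 * C)))
    rw [eventually_inf_principal]
    refine Eventually.of_forall fun ⟨n, I⟩ hnI => ?_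
    rw [Finset.mul_sum]
    refine Finset.sum_le_sum fun i hi => ?_
    have hm := hnI.1 i hi
    have key : ∀ u v : ℝ, u ≤ C → v ≤ C → u ≤ v →
        Real.exp (2 * v) - Real.exp (2 * u) ≤ 2 * Real.exp (2 * C) * (v - u) := by
      intro u v hu hv huv
      have h1 := Real.add_one_le_exp (2 * u - 2 * v)
      have h2 : Real.exp (2 * u) = Real.exp (2 * v) * Real.exp (2 * u - 2 * v) := by
        rw [← Real.exp_add]; ring_nf
      have h3 : Real.exp (2 * v) ≤ Real.exp (2 * C) := Real.exp_le_exp.2 (by linarith)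
      have h4 := Real.exp_pos (2 * v)
      nlinarith
    have b1 := (abs_le.1 (hC _ hm.1)).2
    have b2 := (abs_le.1 (hC _ hm.2)).2
    simp only [Real.dist_eq]
    rcases le_total (P (I i).1) (P (I i).2) with h | h
    · rw [abs_sub_comm, abs_sub_comm (P _), abs_of_nonneg, abs_of_nonneg]
      · exact key _ _ b1 b2 h
      · linarith
      · exact sub_nonneg.2 (Real.exp_le_exp.2 (by linarith))
    · rw [abs_of_nonneg, abs_of_nonneg]
      · exact key _ _ b2 b1 h
      · linarith
      · exact sub_nonneg.2 (Real.exp_le_exp.2 (by linarith))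
  have hd : ∀ᵐ t, t ∈ uIoc 0 x → g t * Real.exp (2 * P t) = deriv (fun t => Real.exp (2 * P t)) t / 2 := by
    filter_upwards [LocallyIntegrable.ae_hasDerivAt_integral hg.locallyIntegrable] with t ht _
    have := (((ht 0).const_mul 2).exp).deriv
    simp only [hP]
    rw [this]; ring
  rw [intervalIntegral.integral_congr_ae hd, intervalIntegral.integral_div, hE.integral_deriv_eq_sub]
  have := Real.exp_pos (2 * P 0)
  linarith

/-- Initial value problems for `-y'' + q y = lam y` with integrable `q` are solvable on `[0, 1]`. -/
theorem exists_schrodingerSolution {q : ℝ → ℂ} (hq : IntegrableOn q (Ioo 0 1)) (lam a b : ℂ) :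
    ∃ y : (ℝ → ℂ) × (ℝ → ℂ), IsSchrodingerSolution q lam y.1 y.2 ∧ y.1 0 = a ∧ y.2 0 = b := by
  set p : ℝ → ℂ := indicator (Ioo 0 1) (fun t => q t - lam) with hp
  have hpi : Integrable p := by
    rw [hp, integrable_indicator_iff measurableSet_Ioo]
    exact hq.sub (integrableOn_const (by simp))
  set g : ℝ → ℝ := fun t => ‖p t‖ with hgdef
  have hg : Integrable g := hpi.norm
  set P : ℝ → ℝ := fun t => ∫ s in (0 : ℝ)..t, g s with hP
  have hPc : Continuous P := intervalIntegral.continuous_primitive (fun _ _ => hg.intervalIntegrable) 0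
  have hPm : Monotone P := by
    intro s t hst
    have : P t - P s = ∫ r in s..t, g r :=
      intervalIntegral.integral_interval_sub_left hg.intervalIntegrable hg.intervalIntegrable
    have h2 : 0 ≤ ∫ r in s..t, g r :=
      intervalIntegral.integral_nonneg_of_forall hst (fun _ => norm_nonneg _)
    linarith
  have hPb : ∀ t, |P t| ≤ ∫ s, g s := by
    intro t
    change ‖∫ s in (0 : ℝ)..t, g s‖ ≤ _
    refine (intervalIntegral.norm_integral_le_integral_norm_uIoc).trans ?_
    have : (∫ s in uIoc 0 t, ‖g s‖) ≤ ∫ s, ‖g s‖ :=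
      setIntegral_le_integral hg.norm (Eventually.of_forall fun _ => norm_nonneg _)
    simpa [hgdef] using this
  set G := ∫ s, g s
  have hG : 0 ≤ G := (abs_nonneg _).trans (hPb 0)
  -- the solution operator
  let Z : (ℝ → ℂ) → ℝ → ℂ := fun u x =>
    b + ∫ t in (0 : ℝ)..x, p t * (a + ∫ s in (0 : ℝ)..t, (Real.exp (2 * P s) : ℂ) * u s)
  have hwc : Continuous fun s => (Real.exp (2 * P s) : ℂ) := by fun_prop
  have hyc : ∀ u : ℝ → ℂ, Continuous u →
      Continuous fun t => a + ∫ s in (0 : ℝ)..t, (Real.exp (2 * P s) : ℂ) * u s := by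
    intro u hu
    exact continuous_const.add (intervalIntegral.continuous_primitive
      (fun _ _ => (hwc.mul hu).intervalIntegrable _ _) 0)
  have hint : ∀ v : ℝ → ℂ, Continuous v → Integrable fun t => p t * v t := by
    intro v hv
    obtain ⟨C, hC⟩ := isCompact_Icc.exists_bound_of_continuousOn (hv.continuousOn (s := Icc (0:ℝ) 1))
    have h1 : Integrable fun t => p t * indicator (Icc (0:ℝ) 1) v t := by
      refine hpi.mul_bdd (c := C) ?_ ?_
      · exact (hv.measurable.indicator measurableSet_Icc).aestronglyMeasurable
      · refine Eventually.of_forall fun t => ?_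
        by_cases ht : t ∈ Icc (0:ℝ) 1
        · simpa [ht] using hC t ht
        · simp only [ht, not_false_eq_true, indicator_of_notMem, norm_zero]
          exact (norm_nonneg _).trans (hC 0 (by simp))
    refine h1.congr (Eventually.of_forall fun t => ?_)
    by_cases ht : t ∈ Ioo (0:ℝ) 1
    · simp [Ioo_subset_Icc_self ht]
    · simp [hp, ht]
  have hZc : ∀ u : ℝ → ℂ, Continuous u → Continuous (Z u) := fun u hu =>
    continuous_const.add (intervalIntegral.continuous_primitive
      (fun _ _ => (hint _ (hyc u hu)).intervalIntegrable) 0)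
  have hZb : ∀ u : ℝ → ℂ, Continuous u → ∃ C, ∀ x, ‖Z u x‖ ≤ C := by
    intro u hu
    refine ⟨‖b‖ + ∫ t, ‖p t * (a + ∫ s in (0 : ℝ)..t, (Real.exp (2 * P s) : ℂ) * u s)‖, fun x => ?_⟩
    refine (norm_add_le _ _).trans (add_le_add_right ?_ _)
    refine (intervalIntegral.norm_integral_le_integral_norm_uIoc).trans ?_
    exact setIntegral_le_integral (hint _ (hyc u hu)).norm (Eventually.of_forall fun _ => norm_nonneg _)
  have hSc : ∀ u : ℝ → ℂ, Continuous u → Continuous fun x => (Real.exp (-(2 * P x)) : ℂ) * Z u x := by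
    intro u hu
    have := hZc u hu
    fun_prop
  have hSb : ∀ u : ℝ → ℂ, Continuous u → ∃ C, ∀ x, ‖(Real.exp (-(2 * P x)) : ℂ) * Z u x‖ ≤ C := by
    intro u hu
    obtain ⟨C, hC⟩ := hZb u hu
    refine ⟨Real.exp (2 * G) * C, fun x => ?_⟩
    rw [norm_mul, Complex.norm_real, Real.norm_of_nonneg (Real.exp_pos _).le]
    have := (abs_le.1 (hPb x)).1
    gcongr
    · linarith
    · exact hC x
  let S : BoundedContinuousFunction ℝ ℂ → BoundedContinuousFunction ℝ ℂ := fun u =>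
    BoundedContinuousFunction.ofNormedAddCommGroup
      (fun x => (Real.exp (-(2 * P x)) : ℂ) * Z u x) (hSc u u.continuous)
      (hSb u u.continuous).choose (hSb u u.continuous).choose_spec
  have hcontr : ContractingWith (1 / 2) S := by
    refine ⟨by norm_num, LipschitzWith.of_dist_le_mul fun u v => ?_⟩
    rw [BoundedContinuousFunction.dist_le (by positivity)]
    intro x
    set N := dist u v with hN
    have hN0 : 0 ≤ N := dist_nonneg
    have hsub : Z u x - Z v x = ∫ t in (0 : ℝ)..x,
        p t * ∫ s in (0 : ℝ)..t, (Real.exp (2 * P s) : ℂ) * (u s - v s) := by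
      simp only [Z]
      rw [add_sub_add_left_eq_sub, ← intervalIntegral.integral_sub
        (hint _ (hyc u u.continuous)).intervalIntegrable (hint _ (hyc v v.continuous)).intervalIntegrable]
      congr 1; ext t
      have := intervalIntegral.integral_sub (μ := volume)
        ((hwc.mul u.continuous).intervalIntegrable 0 t) ((hwc.mul v.continuous).intervalIntegrable 0 t)
      simp only [Pi.mul_apply, ← mul_sub] at this
      rw [this, ← mul_sub, add_sub_add_left_eq_sub]
    have hle : ∀ t, ‖p t * ∫ s in (0 : ℝ)..t, (Real.exp (2 * P s) : ℂ) * (u s - v s)‖ ≤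
        N * (g t * Real.exp (2 * P t)) := by
      intro t
      by_cases ht : t ∈ Ioo (0:ℝ) 1
      · have h1 : ‖∫ s in (0 : ℝ)..t, (Real.exp (2 * P s) : ℂ) * (u s - v s)‖ ≤
            (Real.exp (2 * P t) * N) * |t - 0| := by
          refine intervalIntegral.norm_integral_le_of_norm_le_const fun s hs => ?_
          rw [uIoc_of_le ht.1.le] at hs
          rw [norm_mul, Complex.norm_real, Real.norm_of_nonneg (Real.exp_pos _).le, ← dist_eq_norm]
          have := hPm hs.2
          gcongr
          exact BoundedContinuousFunction.dist_coe_le_dist s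
        rw [norm_mul, sub_zero, abs_of_pos ht.1] at *
        have h2 : ‖∫ s in (0 : ℝ)..t, (Real.exp (2 * P s) : ℂ) * (u s - v s)‖ ≤
            Real.exp (2 * P t) * N :=
          h1.trans (mul_le_of_le_one_right (by positivity) ht.2.le)
        calc _ ≤ ‖p t‖ * (Real.exp (2 * P t) * N) := by gcongr
          _ = _ := by simp only [hgdef]; ring
      · simp [hp, ht, hgdef]
    have hgi : Integrable fun t => g t * Real.exp (2 * P t) := by
      refine hg.mul_bdd (c := Real.exp (2 * G)) (by fun_prop) (Eventually.of_forall fun t => ?_)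
      rw [Real.norm_of_nonneg (Real.exp_pos _).le]
      have := (abs_le.1 (hPb t)).2
      gcongr
    have hmain : ‖Z u x - Z v x‖ ≤ N * (Real.exp (2 * P x) / 2) := by
      rw [hsub]
      rcases le_total 0 x with hx | hx
      · refine (intervalIntegral.norm_integral_le_of_norm_le hx
          (Eventually.of_forall fun t _ => hle t) (hgi.const_mul N).intervalIntegrable).trans ?_
        rw [intervalIntegral.integral_const_mul]
        exact mul_le_mul_of_nonneg_left (integral_mul_exp_le hg x) hN0
      · have : ∀ t ∈ uIcc 0 x, (p t * ∫ s in (0 : ℝ)..t, (Real.exp (2 * P s) : ℂ) * (u s - v s)) = 0 := by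
          intro t ht
          rw [uIcc_of_ge hx] at ht
          have : t ∉ Ioo (0:ℝ) 1 := fun h => absurd ht.2 (not_le.2 h.1)
          simp [hp, this]
        rw [intervalIntegral.integral_congr this]
        simp only [intervalIntegral.integral_zero, norm_zero]
        positivity
    change dist ((Real.exp (-(2 * P x)) : ℂ) * Z u x) ((Real.exp (-(2 * P x)) : ℂ) * Z v x) ≤ _
    rw [dist_eq_norm, ← mul_sub, norm_mul, Complex.norm_real, Real.norm_of_nonneg (Real.exp_pos _).le]
    calc _ ≤ Real.exp (-(2 * P x)) * (N * (Real.exp (2 * P x) / 2)) := by gcongr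
      _ = (Real.exp (-(2 * P x)) * Real.exp (2 * P x)) * (N / 2) := by ring
      _ = N / 2 := by rw [← Real.exp_add]; simp
      _ = _ := by push_cast; ring
  let u := hcontr.fixedPoint
  have hu : S u = u := hcontr.fixedPoint_isFixedPt
  have hzu : ∀ x, (Real.exp (2 * P x) : ℂ) * u x = Z u x := by
    intro x
    have h1 : (Real.exp (-(2 * P x)) : ℂ) * Z u x = u x := congrArg (fun w => w x) hu
    rw [← h1, ← mul_assoc, ← Complex.ofReal_mul, ← Real.exp_add]
    simp
  set z := Z u with hz
  have hzc : Continuous z := hZc u u.continuous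
  set y : ℝ → ℂ := fun t => a + ∫ s in (0 : ℝ)..t, z s with hy
  have hyc' : Continuous y := continuous_const.add (intervalIntegral.continuous_primitive
      (fun _ _ => hzc.intervalIntegrable _ _) 0)
  have hZu : ∀ x, z x =
      b + ∫ t in (0 : ℝ)..x, p t * (a + ∫ s in (0 : ℝ)..t, (Real.exp (2 * P s) : ℂ) * u s) :=
    fun _ => rfl
  have hzeq : ∀ x, z x = b + ∫ t in (0 : ℝ)..x, p t * y t := by
    intro x
    rw [hZu]
    simp only [hy, hzu]
  refine ⟨(y, z), ⟨fun x _ => ?_, ?_, ?_⟩, by simp [hy], by simp [hzeq]⟩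
  · exact ((hzc.integral_hasStrictDerivAt 0 x).hasDerivAt.const_add a).hasDerivWithinAt
  · have h := absCont_complex (hint y hyc')
    have h2 : AbsolutelyContinuousOnInterval (fun _ : ℝ => b) 0 1 := by
      unfold AbsolutelyContinuousOnInterval
      simpa using tendsto_const_nhds
    have := h2.add h
    convert! this using 1
    ext x
    exact hzeq x
  · rw [ae_restrict_iff' measurableSet_Ioo]
    filter_upwards [LocallyIntegrable.ae_hasDerivAt_integral (hint y hyc').locallyIntegrable]
      with x hx hx01
    refine ⟨p x * y x, ?_, ?_⟩
    · have := (hx 0).const_add b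
      refine this.congr_of_eventuallyEq (Eventually.of_forall hzeq)
    · simp only [hp, indicator_of_mem hx01]; ring

/-- The solution of `-y'' + q y = lam y` on `[0, 1]` with `y 0 = a` and `y' 0 = b`, as the pair
`(y, y')`. -/
noncomputable def schrodingerSolution {q : ℝ → ℂ} (hq : IntegrableOn q (Ioo 0 1)) (lam a b : ℂ) :
    (ℝ → ℂ) × (ℝ → ℂ) :=
  Classical.choose (exists_schrodingerSolution hq lam a b)

theorem schrodingerSolution_spec {q : ℝ → ℂ} (hq : IntegrableOn q (Ioo 0 1)) (lam a b : ℂ) :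
    IsSchrodingerSolution q lam (schrodingerSolution hq lam a b).1
        (schrodingerSolution hq lam a b).2 ∧
      (schrodingerSolution hq lam a b).1 0 = a ∧ (schrodingerSolution hq lam a b).2 0 = b :=
  Classical.choose_spec (exists_schrodingerSolution hq lam a b)

/-- `c(x, lam)`: the solution with `c(0) = 1`, `c'(0) = 0`. -/
noncomputable def solC {q : ℝ → ℂ} (hq : IntegrableOn q (Ioo 0 1)) (x : ℝ) (lam : ℂ) : ℂ :=
  (schrodingerSolution hq lam 1 0).1 x

/-- `c'(x, lam)`. -/
noncomputable def solC' {q : ℝ → ℂ} (hq : IntegrableOn q (Ioo 0 1)) (x : ℝ) (lam : ℂ) : ℂ :=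
  (schrodingerSolution hq lam 1 0).2 x

/-- `s(x, lam)`: the solution with `s(0) = 0`, `s'(0) = 1`. -/
noncomputable def solS {q : ℝ → ℂ} (hq : IntegrableOn q (Ioo 0 1)) (x : ℝ) (lam : ℂ) : ℂ :=
  (schrodingerSolution hq lam 0 1).1 x

/-- `s'(x, lam)`. -/
noncomputable def solS' {q : ℝ → ℂ} (hq : IntegrableOn q (Ioo 0 1)) (x : ℝ) (lam : ℂ) : ℂ :=
  (schrodingerSolution hq lam 0 1).2 x

/-- The principal square root of a complex number. -/
noncomputable def complexSqrt (lam : ℂ) : ℂ := lam ^ (1 / 2 : ℂ)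

/-- A multigraph with vertex type `V` and edge type `E` (loops and parallel edges are allowed), with
an orientation: the edge `e` points from `src e` to `tgt e`. -/
structure OrientedMultigraph (V E : Type*) where
  src : E → V
  tgt : E → V

namespace OrientedMultigraph

/-! ### The spectral determinant -/

section SpectralDeterminant

variable {V E : Type*} [Fintype V] [Fintype E] [DecidableEq V] [DecidableEq E]
  (Γ : OrientedMultigraph V E) {q : E → ℝ → ℂ} (hq : ∀ e, IntegrableOn (q e) (Ioo 0 1))

/-- The block `A`: the entry at `(v, u)` is `lam ^ (-1/2)` times the sum of `c_e'(1, lam)` over the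
edges `e` pointing from `u` to `v`. -/
noncomputable def blockA (lam : ℂ) : Matrix V V ℂ := fun v u =>
  1 / complexSqrt lam * ∑ e with Γ.src e = u ∧ Γ.tgt e = v, solC' (hq e) 1 lam

/-- The block `B`: `s_e'(1, lam)` if `e` ends in `v`, and `-1` if `e` starts from `v`; for a loop at
`v` these two contributions are added. -/
noncomputable def blockB (lam : ℂ) : Matrix V E ℂ := fun v e =>
  (if Γ.tgt e = v then solS' (hq e) 1 lam else 0) + (if Γ.src e = v then -1 else 0)

/-- The block `C`: `-1` if `e` ends in `v`, and `c_e(1, lam)` if `e` starts from `v`; for a loop at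
`v` these two contributions are added. -/
noncomputable def blockC (lam : ℂ) : Matrix E V ℂ := fun e v =>
  (if Γ.tgt e = v then -1 else 0) + (if Γ.src e = v then solC (hq e) 1 lam else 0)

/-- The block `D`: the diagonal matrix with entries `lam ^ (1/2) * s_e(1, lam)`. -/
noncomputable def blockD (lam : ℂ) : Matrix E E ℂ :=
  Matrix.diagonal fun e => complexSqrt lam * solS (hq e) 1 lam

/-- The matrix `M` of the linear system formed by the Kirchhoff conditions at the vertices and the
continuity conditions at the incoming ends of the edges. -/
noncomputable def spectralMatrix (lam : ℂ) : Matrix (V ⊕ E) (V ⊕ E) ℂ :=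
  Matrix.fromBlocks (Γ.blockA hq lam) (Γ.blockB hq lam) (Γ.blockC hq lam) (blockD hq lam)

/-- The spectral determinant `det M`. -/
noncomputable def spectralDet (lam : ℂ) : ℂ := (Γ.spectralMatrix hq lam).det

end SpectralDeterminant

/-! ### Odd saturated forests -/

section Forests

variable {V E : Type*} (Γ : OrientedMultigraph V E)

/-- The edge `e` joins `u` and `v`, irrespective of its orientation. -/
def Joins (e : E) (u v : V) : Prop :=
  (Γ.src e = u ∧ Γ.tgt e = v) ∨ (Γ.src e = v ∧ Γ.tgt e = u)

/-- The simple graph on all vertices of `Γ` in which two distinct vertices are adjacent if some edge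
in `τ` joins them. It has the same connected components as the subgraph of `Γ` with all the
vertices and the edge set `τ`. -/
def spanningGraph (τ : Finset E) : SimpleGraph V :=
  SimpleGraph.fromRel fun u v => ∃ e ∈ τ, Γ.Joins e u v

/-- `γ` is the edge set of a cycle in the underlying unoriented multigraph, of length `n + 1` with
`n ≥ 0`: there are distinct vertices `v 0, …, v n` and distinct edges `f 0, …, f n` such that `f i`
joins `v i` and `v (i + 1)`, with indices modulo `n + 1`. A loop is a cycle of length one, and two
parallel edges form a cycle of length two. -/
def IsCycle (γ : Finset E) : Prop :=
  ∃ (n : ℕ) (v : Fin (n + 1) → V) (f : Fin (n + 1) → E),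
    Function.Injective v ∧ Function.Injective f ∧ (∀ i, Γ.Joins (f i) (v i) (v (i + 1))) ∧
      (γ : Set E) = Set.range f

/-- The spanning subgraph with edge set `τ` is a saturated forest: each of its connected components
contains exactly one cycle. -/
def IsSaturatedForest (τ : Finset E) : Prop :=
  ∀ K : (Γ.spanningGraph τ).ConnectedComponent,
    ∃! γ : Finset E, γ ⊆ τ ∧ Γ.IsCycle γ ∧
      ∀ e ∈ γ, (Γ.spanningGraph τ).connectedComponentMk (Γ.src e) = K

/-- The spanning subgraph with edge set `τ` is a saturated forest without even cycles. -/
def IsOddSaturatedForest (τ : Finset E) : Prop :=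
  Γ.IsSaturatedForest τ ∧ ∀ γ ⊆ τ, Γ.IsCycle γ → Odd γ.card

/-- `κ(τ)`: the number of connected components of the spanning subgraph with edge set `τ`. -/
noncomputable def numComponents (τ : Finset E) : ℕ :=
  Nat.card (Γ.spanningGraph τ).ConnectedComponent

end Forests

open scoped Classical in
/-- The sum of `4 ^ κ(τ) * ∏_{e ∉ τ} lam ^ (1/2) * s_e(1, lam)` over all odd saturated forests `τ`. -/
noncomputable def forestSum {V E : Type*} [Fintype E] (Γ : OrientedMultigraph V E)
    {q : E → ℝ → ℂ} (hq : ∀ e, IntegrableOn (q e) (Ioo 0 1)) (lam : ℂ) : ℂ :=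
  ∑ τ : Finset E with Γ.IsOddSaturatedForest τ,
    (4 : ℂ) ^ Γ.numComponents τ * ∏ e with e ∉ τ, complexSqrt lam * solS (hq e) 1 lam

end OrientedMultigraph

/-! Analysis. Put w = (2k+1)π and p = q - λ + w², so that y'' + w²y = p y, where p stays bounded in
L¹ while w → ∞. In Green's identity on [0, 1] against sin(wt) and cos(wt) the boundary terms
collapse, because sin w = 0 and cos w = -1, to w(y(1) + y(0)) and -(y'(1) + y'(0)). Bounding the
integrals gives c'(1) = O(1) and s(1) = O(w⁻²). For c(1) + 1 and s'(1) + 1, replacing the solution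
by cos(wt) or sin(wt)/w leaves the integral of p cos(wt) sin(wt), which tends to 0 by
Riemann-Lebesgue; both quantities are therefore o(1/w).

Perturbation. Let ε = |λ|^(-1/2) and let N be the unoriented incidence matrix, with loops counted
twice. Scaling the V-rows by ε and the E-columns by ε⁻¹ brings M within o(ε) of the bounded matrix
with blocks 0, -N, -Nᵀ, ε⁻¹D, so the determinants differ by o(ε). Undoing the scaling multiplies
this by ε^(|E|-|V|), which is the stated error.

Combinatorics. Expanding the limiting determinant along its diagonal gives a sum over edge sets τ.
The minor of τ vanishes unless |τ| = |V|, and is then (-1)^|V| (det N_τ)². This square is 4^κ(τ) for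
odd saturated forests and 0 otherwise. Labels in an abelian group that are opposite at the ends of
every edge are 2-torsion on an odd cycle, hence 2-torsion and constant on its whole component.
Applied to the basis vectors modulo the column lattice of N_τ, this identifies the quotient with
(ℤ/2)^κ, whence |det N_τ| = 2^κ (`IsOddSaturatedForest.natAbs_det`). Conversely, a nonzero Leibniz
term matches every vertex with an incident edge, so τ is the graph of a function on V and each
component has exactly one cycle; an even cycle would put an alternating vector in the kernel of N_τ.
-/

/-! ### Absolute continuity and integral estimates -/

/-- A continuously differentiable function is absolutely continuous. -/
theorem absolutelyContinuousOnInterval_of_hasDerivWithinAt {f f' : ℝ → ℂ}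
    (hf : ∀ x ∈ Icc (0 : ℝ) 1, HasDerivWithinAt f (f' x) (Icc 0 1) x)
    (hf' : ContinuousOn f' (Icc 0 1)) : AbsolutelyContinuousOnInterval f 0 1 := by
  obtain ⟨C, hC⟩ := isCompact_Icc.exists_bound_of_continuousOn hf'
  have hC0 : 0 ≤ C := (norm_nonneg _).trans (hC 0 (by simp))
  have : LipschitzOnWith ⟨C, hC0⟩ f (Icc 0 1) :=
    (convex_Icc (0 : ℝ) 1).lipschitzOnWith_of_nnnorm_hasDerivWithin_le hf fun x hx => hC x hx
  exact LipschitzOnWith.absolutelyContinuousOnInterval (by rwa [uIcc_of_le zero_le_one])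

/-- The fundamental theorem of calculus for complex absolutely continuous functions. -/
theorem absolutelyContinuousOnInterval_sub_eq_integral {F h : ℝ → ℂ}
    (hF : AbsolutelyContinuousOnInterval F 0 1) (hh : IntegrableOn h (Ioo 0 1))
    (hd : ∀ᵐ x ∂volume.restrict (Ioo (0 : ℝ) 1), HasDerivAt F (h x) x)
    {x : ℝ} (hx : x ∈ Icc (0 : ℝ) 1) : F x - F 0 = ∫ t in (0 : ℝ)..x, h t := by
  set g : ℝ → ℂ := indicator (Ioo 0 1) h with hg
  have hgi : Integrable g := (integrable_indicator_iff measurableSet_Ioo).2 hh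
  have hAC := hF.sub (absCont_complex hgi)
  rw [ae_restrict_iff' measurableSet_Ioo] at hd
  have h0 : ∀ᵐ x : ℝ, x ≠ 0 := by simp [ae_iff]
  have h1 : ∀ᵐ x : ℝ, x ≠ 1 := by simp [ae_iff]
  -- `F` minus the primitive of `h` is absolutely continuous with derivative zero almost everywhere,
  -- hence constant. The endpoints, where nothing is assumed, form a null set.
  obtain ⟨C, hC⟩ := hAC.const_of_ae_hasDerivAt_zero (by
    filter_upwards [hd, LocallyIntegrable.ae_hasDerivAt_integral hgi.locallyIntegrable, h0, h1]
      with t ht1 ht2 ht0 ht3 ht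
    rw [uIcc_of_le zero_le_one] at ht
    have htm : t ∈ Ioo (0 : ℝ) 1 := ⟨lt_of_le_of_ne ht.1 ht0.symm, lt_of_le_of_ne ht.2 ht3⟩
    have := (ht1 htm).sub (ht2 0)
    simpa [hg, htm] using this)
  rw [uIcc_of_le zero_le_one] at hC
  have e0 := hC 0 (by simp)
  have e1 := hC x hx
  simp only [Pi.sub_apply, intervalIntegral.integral_same, sub_zero] at e0 e1
  have e2 : ∫ t in (0 : ℝ)..x, g t = ∫ t in (0 : ℝ)..x, h t := by
    refine intervalIntegral.integral_congr_ae ?_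
    filter_upwards [h1] with t ht1 ht
    rw [uIoc_of_le hx.1] at ht
    rw [hg, indicator_of_mem]
    exact ⟨ht.1, lt_of_le_of_ne (ht.2.trans hx.2) ht1⟩
  rw [← e2, e0, ← e1]
  ring

/-- Products of an integrable function with a function continuous on `[0, 1]` are integrable. -/
theorem MeasureTheory.IntegrableOn.mul_continuousOn_Icc {p g : ℝ → ℂ} (hp : IntegrableOn p (Ioo 0 1))
    (hg : ContinuousOn g (Icc 0 1)) : IntegrableOn (fun t => p t * g t) (Ioo 0 1) := by
  obtain ⟨C, hC⟩ := isCompact_Icc.exists_bound_of_continuousOn hg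
  refine Integrable.mul_bdd (c := C) hp
    ((hg.mono Ioo_subset_Icc_self).aestronglyMeasurable measurableSet_Ioo) ?_
  exact (ae_restrict_iff' measurableSet_Ioo).2
    (Eventually.of_forall fun t ht => hC t (Ioo_subset_Icc_self ht))

theorem norm_integral_mul_le {p g : ℝ → ℂ} (hp : IntegrableOn p (Ioo 0 1)) {R C : ℝ}
    (hR : ∫ t in Ioo (0 : ℝ) 1, ‖p t‖ ≤ R) (hC0 : 0 ≤ C)
    (hC : ∀ t ∈ Icc (0 : ℝ) 1, ‖g t‖ ≤ C) {x : ℝ} (hx : x ∈ Icc (0 : ℝ) 1) :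
    ‖∫ t in (0 : ℝ)..x, p t * g t‖ ≤ R * C := by
  have hpi : IntervalIntegrable p volume 0 x := by
    rw [intervalIntegrable_iff_integrableOn_Ioo_of_le hx.1]
    exact hp.mono_set (Ioo_subset_Ioo_right hx.2)
  calc _ ≤ ∫ t in (0 : ℝ)..x, ‖p t‖ * C := by
        refine intervalIntegral.norm_integral_le_of_norm_le hx.1 (Eventually.of_forall fun t ht => ?_)
          (hpi.norm.mul_const C)
        rw [norm_mul]
        gcongr
        exact hC t ⟨ht.1.le, ht.2.trans hx.2⟩
    _ = (∫ t in Ioo (0 : ℝ) x, ‖p t‖) * C := by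
        rw [intervalIntegral.integral_mul_const, intervalIntegral.integral_of_le hx.1,
          integral_Ioc_eq_integral_Ioo]
    _ ≤ R * C := by
        gcongr
        exact (setIntegral_mono_set hp.norm (Eventually.of_forall fun _ => norm_nonneg _)
          (Ioo_subset_Ioo_right hx.2).eventuallyLE).trans hR

theorem norm_ofReal_sin_le (x : ℝ) : ‖((Real.sin x : ℝ) : ℂ)‖ ≤ 1 := by
  rw [Complex.norm_real]; exact Real.abs_sin_le_one x

theorem norm_ofReal_cos_le (x : ℝ) : ‖((Real.cos x : ℝ) : ℂ)‖ ≤ 1 := by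
  rw [Complex.norm_real]; exact Real.abs_cos_le_one x

theorem integrableOn_shift {q : ℝ → ℂ} (hq : IntegrableOn q (Ioo 0 1)) (a b : ℂ) :
    IntegrableOn (fun t => q t - a + b) (Ioo 0 1) :=
  (hq.sub (integrableOn_const (by simp))).add (integrableOn_const (by simp))

/-! ### Green's identity and a priori bounds for solutions -/

namespace IsSchrodingerSolution

variable {q : ℝ → ℂ} {lam : ℂ} {y y' : ℝ → ℂ}

theorem continuousOn_deriv (h : IsSchrodingerSolution q lam y y') : ContinuousOn y' (Icc 0 1) := by
  simpa [uIcc_of_le] using h.absCont.continuousOn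

theorem continuousOn (h : IsSchrodingerSolution q lam y y') : ContinuousOn y (Icc 0 1) :=
  fun x hx => (h.hasDeriv x hx).continuousWithinAt

/-- Green's identity against a solution `θ` of `-θ'' = w ^ 2 θ`. -/
theorem green (h : IsSchrodingerSolution q lam y y') (hq : IntegrableOn q (Ioo 0 1)) {w : ℂ}
    {θ θ' : ℝ → ℂ} (hθ : ∀ x, HasDerivAt θ (θ' x) x) (hθ' : ∀ x, HasDerivAt θ' (-w ^ 2 * θ x) x)
    {x : ℝ} (hx : x ∈ Icc (0 : ℝ) 1) :
    y' x * θ x - y x * θ' x - (y' 0 * θ 0 - y 0 * θ' 0) =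
      ∫ t in (0 : ℝ)..x, (q t - lam + w ^ 2) * (y t * θ t) := by
  have hθc : Continuous θ := continuous_iff_continuousAt.2 fun x => (hθ x).continuousAt
  have hθc' : Continuous θ' := continuous_iff_continuousAt.2 fun x => (hθ' x).continuousAt
  have a1 : AbsolutelyContinuousOnInterval θ 0 1 :=
    absolutelyContinuousOnInterval_of_hasDerivWithinAt (fun x _ => (hθ x).hasDerivWithinAt)
      hθc'.continuousOn
  have a2 : AbsolutelyContinuousOnInterval θ' 0 1 :=
    absolutelyContinuousOnInterval_of_hasDerivWithinAt (fun x _ => (hθ' x).hasDerivWithinAt)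
      (by fun_prop)
  have a3 : AbsolutelyContinuousOnInterval y 0 1 :=
    absolutelyContinuousOnInterval_of_hasDerivWithinAt h.hasDeriv h.continuousOn_deriv
  have hF := (h.absCont.smul a1).sub (a3.smul a2)
  have hp := integrableOn_shift hq lam (w ^ 2)
  refine absolutelyContinuousOnInterval_sub_eq_integral hF
    (hp.mul_continuousOn_Icc (g := fun t => y t * θ t)
      (h.continuousOn.mul hθc.continuousOn)) ?_ hx
  have hm := ae_restrict_mem (μ := volume) (measurableSet_Ioo (a := (0 : ℝ)) (b := 1))
  filter_upwards [h.equation, hm] with t ⟨y'', h1, h2⟩ ht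
  have h3 : HasDerivAt y (y' t) t :=
    (h.hasDeriv t (Ioo_subset_Icc_self ht)).hasDerivAt (Icc_mem_nhds ht.1 ht.2)
  have h4 : y'' = q t * y t - lam * y t := by rw [← h2]; ring
  -- The terms `y' * θ'` cancel in the derivative of the Wronskian.
  refine ((h1.mul (hθ t)).sub (h3.mul (hθ' t))).congr_deriv ?_
  rw [h4]; ring

/-- Variation of constants. -/
theorem variation_of_constants (h : IsSchrodingerSolution q lam y y')
    (hq : IntegrableOn q (Ioo 0 1)) (w : ℝ) {x : ℝ} (hx : x ∈ Icc (0 : ℝ) 1) :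
    w * y x - (w * (y 0 * Real.cos (w * x)) + y' 0 * Real.sin (w * x)) =
      ∫ t in (0 : ℝ)..x, (q t - lam + (w : ℂ) ^ 2) * (y t * Real.sin (w * (x - t))) := by
  -- The test function sin(w(x - t)) vanishes at t = x with derivative -w, so only `w * y x`
  -- survives at the upper end.
  have hin : ∀ t : ℝ, HasDerivAt (fun t : ℝ => w * (x - t)) (-w) t := fun t => by
    simpa using ((hasDerivAt_id t).const_sub x).const_mul w
  have h1 : ∀ t : ℝ, HasDerivAt (fun t : ℝ => ((Real.sin (w * (x - t)) : ℝ) : ℂ))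
      (-w * Real.cos (w * (x - t))) t := fun t => by
    have := ((hin t).sin).ofReal_comp
    convert! this using 1
    push_cast; ring
  have h2 : ∀ t : ℝ, HasDerivAt (fun t : ℝ => (-w * Real.cos (w * (x - t)) : ℂ))
      (-(w : ℂ) ^ 2 * Real.sin (w * (x - t))) t := fun t => by
    have := (((hin t).cos).ofReal_comp).const_mul (-w : ℂ)
    convert! this using 1
    push_cast; ring
  rw [← h.green hq h1 h2 hx]
  simp
  ring

section Bounds

variable (h : IsSchrodingerSolution q lam y y') (hq : IntegrableOn q (Ioo 0 1)) {w R : ℝ}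
  (hR : ∫ t in Ioo (0 : ℝ) 1, ‖q t - lam + (w : ℂ) ^ 2‖ ≤ R) (hw : 0 < w) (hRw : 2 * R ≤ w)

include h hq hR hw hRw

/-- At a maximum point of |y|, the integral in the variation of constants formula is at most R|y| ≤
w|y|/2, which is absorbed into the left side w|y|. -/
theorem norm_le {x : ℝ} (hx : x ∈ Icc (0 : ℝ) 1) : ‖y x‖ ≤ 2 * (‖y 0‖ + ‖y' 0‖ / w) := by
  obtain ⟨z, hz, hmax⟩ := isCompact_Icc.exists_isMaxOn (nonempty_Icc.2 (zero_le_one' ℝ))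
    h.continuousOn.norm
  refine (hmax hx).trans ?_
  have hint := norm_integral_mul_le (integrableOn_shift hq lam ((w : ℂ) ^ 2)) hR (norm_nonneg (y z))
    (g := fun t => y t * Real.sin (w * (z - t))) (fun t ht => by
      rw [norm_mul]
      exact (mul_le_of_le_one_right (norm_nonneg _) (norm_ofReal_sin_le _)).trans (hmax ht)) hz
  rw [← h.variation_of_constants hq w hz] at hint
  have h1 := norm_sub_norm_le (w * y z)
    (w * (y 0 * Real.cos (w * z)) + y' 0 * Real.sin (w * z) : ℂ)
  have h2 := norm_add_le (w * (y 0 * Real.cos (w * z)) : ℂ) (y' 0 * Real.sin (w * z) : ℂ)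
  have h3 : ‖(w * (y 0 * Real.cos (w * z)) : ℂ)‖ ≤ w * ‖y 0‖ := by
    rw [norm_mul, norm_mul, Complex.norm_real, Real.norm_of_nonneg hw.le]
    gcongr
    exact mul_le_of_le_one_right (norm_nonneg _) (norm_ofReal_cos_le _)
  have h4 : ‖(y' 0 * Real.sin (w * z) : ℂ)‖ ≤ ‖y' 0‖ := by
    rw [norm_mul]
    exact mul_le_of_le_one_right (norm_nonneg _) (norm_ofReal_sin_le _)
  have h5 : ‖w * y z‖ = w * ‖y z‖ := by
    rw [norm_mul, Complex.norm_real, Real.norm_of_nonneg hw.le]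
  have h6 : R * ‖y z‖ ≤ w / 2 * ‖y z‖ := by gcongr; linarith
  have h7 : w * ‖y z‖ ≤ w * (2 * (‖y 0‖ + ‖y' 0‖ / w)) := by
    have : w * (2 * (‖y 0‖ + ‖y' 0‖ / w)) = 2 * (w * ‖y 0‖ + ‖y' 0‖) := by field_simp
    rw [this]; linarith
  exact le_of_mul_le_mul_left h7 hw

/-- Feeding the a priori bound back into the integral gains a factor 1/w over the size of the free
solution. -/
theorem norm_sub_free_le {x : ℝ} (hx : x ∈ Icc (0 : ℝ) 1) :
    ‖y x - (y 0 * Real.cos (w * x) + y' 0 * Real.sin (w * x) / w)‖ ≤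
      2 * R * (‖y 0‖ + ‖y' 0‖ / w) / w := by
  have hint := norm_integral_mul_le (integrableOn_shift hq lam ((w : ℂ) ^ 2)) hR
    (C := 2 * (‖y 0‖ + ‖y' 0‖ / w)) (by positivity)
    (g := fun t => y t * Real.sin (w * (x - t))) (fun t ht => by
      rw [norm_mul]
      exact (mul_le_of_le_one_right (norm_nonneg _) (norm_ofReal_sin_le _)).trans
        (h.norm_le hq hR hw hRw ht)) hx
  rw [← h.variation_of_constants hq w hx] at hint
  have hw' : (w : ℂ) ≠ 0 := by exact_mod_cast hw.ne'
  have : w * y x - (w * (y 0 * Real.cos (w * x)) + y' 0 * Real.sin (w * x)) =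
      w * (y x - (y 0 * Real.cos (w * x) + y' 0 * Real.sin (w * x) / w)) := by
    field_simp
  rw [this, norm_mul, Complex.norm_real, Real.norm_of_nonneg hw.le] at hint
  rw [le_div_iff₀ hw]
  linarith

/-- The integral in Green's identity, for a test function of modulus at most one. -/
theorem norm_integral_le {θ : ℝ → ℂ} (hθ1 : ∀ t, ‖θ t‖ ≤ 1) :
    ‖∫ t in (0 : ℝ)..1, (q t - lam + (w : ℂ) ^ 2) * (y t * θ t)‖ ≤
      2 * R * (‖y 0‖ + ‖y' 0‖ / w) := by
  refine (norm_integral_mul_le (integrableOn_shift hq lam ((w : ℂ) ^ 2)) hR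
    (C := 2 * (‖y 0‖ + ‖y' 0‖ / w)) (by positivity) (fun t ht => ?_) (by simp)).trans_eq (by ring)
  rw [norm_mul]
  exact (mul_le_of_le_one_right (norm_nonneg _) (hθ1 _)).trans (h.norm_le hq hR hw hRw ht)

/-- Replacing the solution by the free solution in the integral of Green's identity. -/
theorem norm_integral_sub_free_le {θ : ℝ → ℂ} (hθ : Continuous θ) (hθ1 : ∀ t, ‖θ t‖ ≤ 1) :
    ‖(∫ t in (0 : ℝ)..1, (q t - lam + (w : ℂ) ^ 2) * (y t * θ t)) -
        ∫ t in (0 : ℝ)..1, (q t - lam + (w : ℂ) ^ 2) *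
          ((y 0 * Real.cos (w * t) + y' 0 * Real.sin (w * t) / w) * θ t)‖ ≤
      2 * R ^ 2 * (‖y 0‖ + ‖y' 0‖ / w) / w := by
  have hp := integrableOn_shift hq lam ((w : ℂ) ^ 2)
  have hR0 : 0 ≤ R := (integral_nonneg fun _ => norm_nonneg _).trans hR
  have hi : ∀ g : ℝ → ℂ, ContinuousOn g (Icc 0 1) →
      IntervalIntegrable (fun t => (q t - lam + (w : ℂ) ^ 2) * g t) volume 0 1 := fun g hg => by
    rw [intervalIntegrable_iff_integrableOn_Ioo_of_le zero_le_one]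
    exact hp.mul_continuousOn_Icc hg
  rw [← intervalIntegral.integral_sub (hi (fun t => y t * θ t)
    (h.continuousOn.mul hθ.continuousOn)) (hi _ (by fun_prop))]
  simp_rw [← mul_sub, ← sub_mul]
  refine (norm_integral_mul_le hp hR (C := 2 * R * (‖y 0‖ + ‖y' 0‖ / w) / w) (by positivity)
    (fun t ht => ?_) (by simp)).trans_eq (by ring)
  rw [norm_mul]
  exact (mul_le_of_le_one_right (norm_nonneg _) (hθ1 _)).trans (h.norm_sub_free_le hq hR hw hRw ht)

end Bounds

end IsSchrodingerSolution

/-! ### Oscillatory integrals at odd multiples of π -/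

/-- The Riemann-Lebesgue lemma at the frequencies `2 * (2 * k + 1) * π`. -/
theorem tendsto_integral_mul_cos_mul_sin {f : ℝ → ℂ} (hf : IntegrableOn f (Ioo 0 1)) :
    Tendsto (fun k : ℕ => ∫ t in (0 : ℝ)..1, f t * ((Real.cos ((2 * k + 1) * Real.pi * t) : ℂ) *
      (Real.sin ((2 * k + 1) * Real.pi * t) : ℂ))) atTop (𝓝 0) := by
  set g : ℝ → ℂ := indicator (Ioo 0 1) f with hg
  have hgi : Integrable g := (integrable_indicator_iff measurableSet_Ioo).2 hf
  have hJ := Real.tendsto_integral_exp_smul_cocompact g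
  set J : ℝ → ℂ := fun w => ∫ v : ℝ, Real.fourierChar (-(v * w)) • g v with hJdef
  -- Since cos · sin is half the sine of the doubled angle and `Real.fourierChar` already contains
  -- 2π, the integral is a combination of Fourier transforms at ±(2k+1).
  have h1 : Tendsto (fun k : ℕ => (2 * k + 1 : ℝ)) atTop atTop :=
    tendsto_atTop_add_const_right _ _
      (tendsto_natCast_atTop_atTop.const_mul_atTop (by norm_num))
  have h2 := hJ.comp (h1.mono_right atTop_le_cocompact)
  have h3 := hJ.comp ((tendsto_neg_atTop_atBot.comp h1).mono_right atBot_le_cocompact)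
  have hint : ∀ w : ℝ, Integrable fun v : ℝ => Real.fourierChar (-(v * w)) • g v := fun w => by
    have := (Real.fourierIntegral_convergent_iff (μ := volume) (f := g) w).2 hgi
    refine this.congr (Eventually.of_forall fun v => ?_)
    simp [mul_comm]
  have key : ∀ k : ℕ, ∫ t in (0 : ℝ)..1, f t * ((Real.cos ((2 * k + 1) * Real.pi * t) : ℂ) *
      (Real.sin ((2 * k + 1) * Real.pi * t) : ℂ)) =
      (J (-(2 * k + 1)) - J (2 * k + 1)) * (1 / (4 * Complex.I)) := by
    intro k
    rw [hJdef]
    simp only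
    rw [← integral_sub (hint _) (hint _), ← integral_mul_const,
      intervalIntegral.integral_of_le zero_le_one, integral_Ioc_eq_integral_Ioo,
      ← integral_indicator measurableSet_Ioo]
    congr 1; ext t
    by_cases ht : t ∈ Ioo (0 : ℝ) 1
    · simp only [hg, indicator_of_mem ht, Circle.smul_def, Real.fourierChar_apply, smul_eq_mul,
        Complex.ofReal_sin, Complex.ofReal_cos]
      have e2 : Complex.cos (((2 * k + 1) * Real.pi * t : ℝ) : ℂ) *
          Complex.sin (((2 * k + 1) * Real.pi * t : ℝ) : ℂ) =
          Complex.sin (2 * (((2 * k + 1) * Real.pi * t : ℝ) : ℂ)) / 2 := by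
        rw [Complex.sin_two_mul]; ring
      rw [e2, Complex.sin]
      have e3 : -(2 * (((2 * k + 1) * Real.pi * t : ℝ) : ℂ)) * Complex.I =
        ((2 * Real.pi * (-(t * (2 * k + 1))) : ℝ) : ℂ) * Complex.I := by push_cast; ring
      have e4 : (2 * (((2 * k + 1) * Real.pi * t : ℝ) : ℂ)) * Complex.I =
        ((2 * Real.pi * (-(t * (-(2 * k + 1)))) : ℝ) : ℂ) * Complex.I := by push_cast; ring
      rw [e3, e4]
      have hI : 1 / (4 * Complex.I) = -Complex.I / 4 := by
        rw [one_div, mul_inv, Complex.inv_I]; ring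
      rw [hI]
      ring
    · simp [hg, ht]
  simp_rw [key]
  simpa using (h3.sub h2).mul_const (1 / (4 * Complex.I))

theorem sin_odd_mul_pi (k : ℕ) : Real.sin ((2 * k + 1) * Real.pi) = 0 := by
  simpa using Real.sin_nat_mul_pi (2 * k + 1)

theorem cos_odd_mul_pi (k : ℕ) : Real.cos ((2 * k + 1) * Real.pi) = -1 := by
  have := Real.cos_nat_mul_pi (2 * k + 1)
  rw [pow_succ, pow_mul] at this
  simpa using this

theorem hasDerivAt_ofReal_sin (w x : ℝ) :
    HasDerivAt (fun t : ℝ => ((Real.sin (w * t) : ℝ) : ℂ)) (w * Real.cos (w * x)) x := by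
  have hin : HasDerivAt (fun t : ℝ => w * t) w x := by simpa using (hasDerivAt_id x).const_mul w
  refine (hin.sin.ofReal_comp).congr_deriv ?_
  push_cast; ring

theorem hasDerivAt_ofReal_cos (w x : ℝ) :
    HasDerivAt (fun t : ℝ => ((Real.cos (w * t) : ℝ) : ℂ)) (-w * Real.sin (w * x)) x := by
  have hin : HasDerivAt (fun t : ℝ => w * t) w x := by simpa using (hasDerivAt_id x).const_mul w
  refine (hin.cos.ofReal_comp).congr_deriv ?_
  push_cast; ring

namespace IsSchrodingerSolution

variable {q : ℝ → ℂ} {lam : ℂ} {y y' : ℝ → ℂ}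

/-- Testing against sin(wt), which vanishes at both ends, removes y' from the boundary terms. -/
theorem mul_one_add (h : IsSchrodingerSolution q lam y y') (hq : IntegrableOn q (Ioo 0 1))
    {w : ℝ} (hs : Real.sin w = 0) (hc : Real.cos w = -1) :
    w * (y 1 + y 0) =
      ∫ t in (0 : ℝ)..1, (q t - lam + (w : ℂ) ^ 2) * (y t * Real.sin (w * t)) := by
  rw [← h.green hq (hasDerivAt_ofReal_sin w) (fun x => ((hasDerivAt_ofReal_cos w x).const_mul
    (w : ℂ)).congr_deriv (by ring)) (by simp)]
  simp only [mul_one, hs, hc, mul_zero, Real.sin_zero, Real.cos_zero]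
  push_cast; ring

/-- Testing against cos(wt), whose derivative vanishes at both ends, removes y from the boundary
terms. -/
theorem deriv_one_add (h : IsSchrodingerSolution q lam y y') (hq : IntegrableOn q (Ioo 0 1))
    {w : ℝ} (hs : Real.sin w = 0) (hc : Real.cos w = -1) :
    -(y' 1 + y' 0) =
      ∫ t in (0 : ℝ)..1, (q t - lam + (w : ℂ) ^ 2) * (y t * Real.cos (w * t)) := by
  rw [← h.green hq (hasDerivAt_ofReal_cos w) (fun x => ((hasDerivAt_ofReal_sin w x).const_mul
    (-w : ℂ)).congr_deriv (by ring)) (by simp)]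
  simp only [mul_one, hs, hc, mul_zero, Real.sin_zero, Real.cos_zero]
  push_cast; ring

end IsSchrodingerSolution

/-! ### Asymptotics of the fundamental solutions at the endpoint -/

section Asymptotics

variable {q : ℝ → ℂ} (hq : IntegrableOn q (Ioo 0 1)) {ι : Type*} {l : Filter ι} {k : ι → ℕ}
  (hk : Tendsto k l atTop) {lam : ι → ℂ}
  (hlam : (fun i => lam i - ((2 * (k i : ℂ) + 1) ^ 2 * (Real.pi : ℂ) ^ 2)) =O[l]
      fun _ => (1 : ℝ))

include hk in
theorem tendsto_odd_mul_pi_atTop : Tendsto (fun i => (2 * (k i : ℝ) + 1) * Real.pi) l atTop :=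
  (tendsto_atTop_add_const_right _ _ ((tendsto_natCast_atTop_atTop.comp hk).const_mul_atTop
    (by norm_num : (0 : ℝ) < 2))).atTop_mul_const Real.pi_pos

include hlam in
theorem exists_eventually_norm_sub_sq_le : ∃ K : ℝ, 0 ≤ K ∧ ∀ᶠ i in l,
    ‖lam i - (((2 * (k i : ℝ) + 1) * Real.pi : ℝ) : ℂ) ^ 2‖ ≤ K := by
  obtain ⟨K, hK, h⟩ := hlam.exists_nonneg
  refine ⟨K, hK, h.bound.mono fun i hi => ?_⟩
  have : (((2 * (k i : ℝ) + 1) * Real.pi : ℝ) : ℂ) ^ 2 = (2 * (k i : ℂ) + 1) ^ 2 * (Real.pi : ℂ) ^ 2 := by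
    push_cast; ring
  rw [this]
  simpa using hi

include hq hk hlam in
-- The effective potential differs from q by the bounded number λ - w², so one R serves for all
-- indices, while w → ∞ eventually exceeds 2R.
theorem exists_eventually_potential_bound : ∃ R : ℝ, 0 ≤ R ∧ ∀ᶠ i in l,
    (∫ t in Ioo (0 : ℝ) 1, ‖q t - lam i + (((2 * (k i : ℝ) + 1) * Real.pi : ℝ) : ℂ) ^ 2‖ ≤ R) ∧
      0 < (2 * (k i : ℝ) + 1) * Real.pi ∧ 2 * R ≤ (2 * (k i : ℝ) + 1) * Real.pi := by
  obtain ⟨K, hK0, hK⟩ := exists_eventually_norm_sub_sq_le hlam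
  have hQ : 0 ≤ ∫ t in Ioo (0 : ℝ) 1, ‖q t‖ := integral_nonneg fun _ => norm_nonneg _
  refine ⟨(∫ t in Ioo (0 : ℝ) 1, ‖q t‖) + K, by positivity, ?_⟩
  have ht := tendsto_odd_mul_pi_atTop hk
  filter_upwards [hK, ht.eventually_gt_atTop 0, ht.eventually_ge_atTop _] with i h1 h2 h3
  refine ⟨?_, h2, h3⟩
  have : (∫ t in Ioo (0 : ℝ) 1, ‖q t‖) + K = ∫ t in Ioo (0 : ℝ) 1, (‖q t‖ + K) := by
    rw [integral_add hq.norm (integrableOn_const (by simp))]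
    simp
  rw [this]
  refine integral_mono (integrableOn_shift hq _ _).norm
    (hq.norm.add (integrableOn_const (by simp))) fun t => ?_
  simp only
  have e : q t - lam i + (((2 * (k i : ℝ) + 1) * Real.pi : ℝ) : ℂ) ^ 2 =
    q t - (lam i - (((2 * (k i : ℝ) + 1) * Real.pi : ℝ) : ℂ) ^ 2) := by ring
  rw [e]
  exact (norm_sub_le _ _).trans (by gcongr)

include hq hk hlam in
-- Riemann-Lebesgue is applied separately to q and to the constant function 1; the latter carries
-- only the bounded coefficient λ - w².
theorem tendsto_integral_shift_mul_cos_mul_sin :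
    Tendsto (fun i => ∫ t in (0 : ℝ)..1,
      (q t - lam i + (((2 * (k i : ℝ) + 1) * Real.pi : ℝ) : ℂ) ^ 2) *
        ((Real.cos ((2 * k i + 1) * Real.pi * t) : ℂ) *
          (Real.sin ((2 * k i + 1) * Real.pi * t) : ℂ))) l (𝓝 0) := by
  obtain ⟨K, hK0, hK⟩ := exists_eventually_norm_sub_sq_le hlam
  have h1 := (tendsto_integral_mul_cos_mul_sin hq).comp hk
  have h2 := (tendsto_integral_mul_cos_mul_sin (f := fun _ => 1) (integrableOn_const (by simp))).comp hk
  have h3 : Tendsto (fun i => (lam i - (((2 * (k i : ℝ) + 1) * Real.pi : ℝ) : ℂ) ^ 2) *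
      ∫ t in (0 : ℝ)..1, (1 : ℂ) * ((Real.cos ((2 * k i + 1) * Real.pi * t) : ℂ) *
          (Real.sin ((2 * k i + 1) * Real.pi * t) : ℂ))) l (𝓝 0) :=
    isBoundedUnder_le_mul_tendsto_zero ⟨K, hK⟩ h2
  have h4 := h1.sub h3
  rw [sub_zero] at h4
  refine h4.congr fun i => ?_
  rw [Function.comp_apply, ← intervalIntegral.integral_const_mul, ← intervalIntegral.integral_sub]
  · congr 1; ext t; ring
  · rw [intervalIntegrable_iff_integrableOn_Ioo_of_le zero_le_one]
    exact hq.mul_continuousOn_Icc (by fun_prop)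
  · apply Continuous.intervalIntegrable; fun_prop

include hk hlam in
-- By Green's identity w(c(1) + 1) is the integral of p c sin(wt). Replacing c by cos(wt) costs
-- O(1/w), and the remaining integral tends to 0.
theorem solC_add_one_isLittleO : (fun i => solC hq 1 (lam i) + 1) =o[l]
    fun i => ((2 * (k i : ℝ) + 1) * Real.pi)⁻¹ := by
  obtain ⟨R, hR0, hR⟩ := exists_eventually_potential_bound hq hk hlam
  have hfree := tendsto_integral_shift_mul_cos_mul_sin hq hk hlam
  have ht := tendsto_odd_mul_pi_atTop hk
  have hlim := hfree.norm.add (ht.inv_tendsto_atTop.const_mul (2 * R ^ 2))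
  simp only [norm_zero, mul_zero, add_zero] at hlim
  refine IsLittleO.of_bound fun c hc => ?_
  filter_upwards [hR, hlim.eventually_le_const hc] with i ⟨h1, h2, h3⟩ h4
  obtain ⟨hs, h0, h0'⟩ := schrodingerSolution_spec hq (lam i) 1 0
  have e1 := hs.mul_one_add hq (sin_odd_mul_pi (k i)) (cos_odd_mul_pi (k i))
  have e2 := hs.norm_integral_sub_free_le hq h1 h2 h3
    (θ := fun t => (Real.sin ((2 * (k i : ℝ) + 1) * Real.pi * t) : ℂ)) (by fun_prop)
    fun t => norm_ofReal_sin_le _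
  rw [← e1, h0, h0'] at e2
  have e3 := norm_le_norm_add_norm_sub' ((((2 * (k i : ℝ) + 1) * Real.pi : ℝ) : ℂ) *
    ((schrodingerSolution hq (lam i) 1 0).1 1 + 1)) (∫ t in (0 : ℝ)..1,
      (q t - lam i + (((2 * (k i : ℝ) + 1) * Real.pi : ℝ) : ℂ) ^ 2) *
        ((Real.cos ((2 * k i + 1) * Real.pi * t) : ℂ) *
          (Real.sin ((2 * k i + 1) * Real.pi * t) : ℂ)))
  simp only [one_mul, zero_mul, zero_div, add_zero, norm_zero, norm_one, mul_one] at e2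
  rw [norm_mul, Complex.norm_real, Real.norm_of_nonneg h2.le] at e3
  rw [norm_inv, Real.norm_of_nonneg h2.le, ← div_eq_mul_inv, le_div_iff₀ h2, mul_comm]
  refine e3.trans (le_trans ?_ h4)
  gcongr
  simpa [div_eq_mul_inv] using e2

include hk hlam in
-- The argument for c(1) + 1 with the roles exchanged: s is close to sin(wt)/w and the test function
-- is cos(wt), so the same product cos · sin appears, now with the factor 1/w.
theorem solS'_add_one_isLittleO : (fun i => solS' hq 1 (lam i) + 1) =o[l]
    fun i => ((2 * (k i : ℝ) + 1) * Real.pi)⁻¹ := by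
  obtain ⟨R, hR0, hR⟩ := exists_eventually_potential_bound hq hk hlam
  have hfree := tendsto_integral_shift_mul_cos_mul_sin hq hk hlam
  have ht := tendsto_odd_mul_pi_atTop hk
  have hlim := hfree.norm.add (ht.inv_tendsto_atTop.const_mul (2 * R ^ 2))
  simp only [norm_zero, mul_zero, add_zero] at hlim
  refine IsLittleO.of_bound fun c hc => ?_
  filter_upwards [hR, hlim.eventually_le_const hc] with i ⟨h1, h2, h3⟩ h4
  obtain ⟨hs, h0, h0'⟩ := schrodingerSolution_spec hq (lam i) 0 1
  have e1 := hs.deriv_one_add hq (sin_odd_mul_pi (k i)) (cos_odd_mul_pi (k i))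
  have e2 := hs.norm_integral_sub_free_le hq h1 h2 h3
    (θ := fun t => (Real.cos ((2 * (k i : ℝ) + 1) * Real.pi * t) : ℂ)) (by fun_prop)
    fun t => norm_ofReal_cos_le _
  rw [← e1, h0, h0'] at e2
  set w : ℝ := (2 * (k i : ℝ) + 1) * Real.pi with hw
  set Z : ℂ := ∫ t in (0 : ℝ)..1, (q t - lam i + (w : ℂ) ^ 2) *
        ((Real.cos (w * t) : ℂ) * (Real.sin (w * t) : ℂ)) with hZ
  have e4 : (∫ t in (0 : ℝ)..1, (q t - lam i + (w : ℂ) ^ 2) *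
      ((0 * (Real.cos (w * t) : ℂ) + 1 * (Real.sin (w * t) : ℂ) / w) * (Real.cos (w * t) : ℂ))) =
      Z / w := by
    rw [hZ, ← intervalIntegral.integral_div]
    congr 1; ext t; ring
  rw [e4] at e2
  have e3 := norm_le_norm_add_norm_sub' (-((schrodingerSolution hq (lam i) 0 1).2 1 + 1)) (Z / w)
  simp only [norm_zero, norm_one, zero_add] at e2
  rw [norm_neg, norm_div, Complex.norm_real, Real.norm_of_nonneg h2.le] at e3
  rw [norm_inv, Real.norm_of_nonneg h2.le, ← div_eq_mul_inv, le_div_iff₀ h2, mul_comm]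
  refine le_trans ?_ h4
  calc _ ≤ w * (‖Z‖ / w + 2 * R ^ 2 * (1 / w) / w) := by
        gcongr; exact e3.trans (by gcongr)
    _ = _ := by
        simp only [Pi.inv_apply, ← hw]; field_simp

include hk hlam in
theorem solC'_isBigO_one : (fun i => solC' hq 1 (lam i)) =O[l] fun _ => (1 : ℝ) := by
  obtain ⟨R, hR0, hR⟩ := exists_eventually_potential_bound hq hk hlam
  refine IsBigO.of_bound (2 * R) ?_
  filter_upwards [hR] with i ⟨h1, h2, h3⟩
  obtain ⟨hs, h0, h0'⟩ := schrodingerSolution_spec hq (lam i) 1 0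
  have e1 := hs.deriv_one_add hq (sin_odd_mul_pi (k i)) (cos_odd_mul_pi (k i))
  have e2 := hs.norm_integral_le hq h1 h2 h3
    (θ := fun t => (Real.cos ((2 * (k i : ℝ) + 1) * Real.pi * t) : ℂ))
    fun t => norm_ofReal_cos_le _
  rw [← e1, h0, h0'] at e2
  simpa [solC'] using e2

include hk hlam in
-- One factor 1/w comes from Green's identity, the other from s itself being of size 1/w.
theorem solS_isBigO : (fun i => solS hq 1 (lam i)) =O[l]
    fun i => ((2 * (k i : ℝ) + 1) * Real.pi)⁻¹ ^ 2 := by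
  obtain ⟨R, hR0, hR⟩ := exists_eventually_potential_bound hq hk hlam
  refine IsBigO.of_bound (2 * R) ?_
  filter_upwards [hR] with i ⟨h1, h2, h3⟩
  obtain ⟨hs, h0, h0'⟩ := schrodingerSolution_spec hq (lam i) 0 1
  have e1 := hs.mul_one_add hq (sin_odd_mul_pi (k i)) (cos_odd_mul_pi (k i))
  have e2 := hs.norm_integral_le hq h1 h2 h3
    (θ := fun t => (Real.sin ((2 * (k i : ℝ) + 1) * Real.pi * t) : ℂ))
    fun t => norm_ofReal_sin_le _
  rw [← e1, h0, h0', norm_mul, Complex.norm_real, Real.norm_of_nonneg h2.le] at e2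
  simp only [add_zero, norm_zero, zero_add, norm_one] at e2
  rw [norm_pow, norm_inv, Real.norm_of_nonneg h2.le, inv_pow, ← div_eq_mul_inv,
    le_div_iff₀ (by positivity)]
  set w : ℝ := (2 * (k i : ℝ) + 1) * Real.pi with hw
  calc _ = w * (w * ‖solS hq 1 (lam i)‖) := by ring
    _ ≤ w * (2 * R * (1 / w)) := mul_le_mul_of_nonneg_left e2 h2.le
    _ = _ := by field_simp

/-- The estimates see only the modulus of the root, so the choice of branch plays no role in them.
-/
theorem norm_complexSqrt (z : ℂ) : ‖complexSqrt z‖ = ‖z‖ ^ (1 / 2 : ℝ) := by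
  have h1 : complexSqrt z ^ 2 = z := by
    rw [complexSqrt, ← Complex.cpow_nat_mul]; simp
  rw [← Real.sqrt_eq_rpow]
  conv_rhs => rw [← h1, norm_pow, Real.sqrt_sq (norm_nonneg _)]

include hk hlam in
theorem norm_tendsto_atTop : Tendsto (fun i => ‖lam i‖) l atTop := by
  obtain ⟨K, hK0, hK⟩ := exists_eventually_norm_sub_sq_le hlam
  have ht := tendsto_odd_mul_pi_atTop hk
  refine tendsto_atTop_mono' l ?_ (tendsto_atTop_add_const_right l (-K) ht)
  filter_upwards [hK, ht.eventually_ge_atTop 1] with i h1 h2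
  have h3 : ‖(((2 * (k i : ℝ) + 1) * Real.pi : ℝ) : ℂ) ^ 2‖ = ((2 * (k i : ℝ) + 1) * Real.pi) ^ 2 := by
    rw [norm_pow, Complex.norm_real, Real.norm_of_nonneg (by linarith)]
  have h4 := norm_le_norm_add_norm_sub' ((((2 * (k i : ℝ) + 1) * Real.pi : ℝ) : ℂ) ^ 2) (lam i)
  rw [norm_sub_rev] at h1
  nlinarith

include hk hlam in
theorem norm_rpow_half_isBigO : (fun i => ‖lam i‖ ^ (1 / 2 : ℝ)) =O[l]
    fun i => (2 * (k i : ℝ) + 1) * Real.pi := by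
  obtain ⟨K, hK0, hK⟩ := exists_eventually_norm_sub_sq_le hlam
  have ht := tendsto_odd_mul_pi_atTop hk
  refine IsBigO.of_bound (1 + K) ?_
  filter_upwards [hK, ht.eventually_ge_atTop 1] with i h1 h2
  have h3 : ‖(((2 * (k i : ℝ) + 1) * Real.pi : ℝ) : ℂ) ^ 2‖ = ((2 * (k i : ℝ) + 1) * Real.pi) ^ 2 := by
    rw [norm_pow, Complex.norm_real, Real.norm_of_nonneg (by linarith)]
  have h4 := norm_le_norm_add_norm_sub' (lam i) ((((2 * (k i : ℝ) + 1) * Real.pi : ℝ) : ℂ) ^ 2)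
  rw [h3] at h4
  set w := (2 * (k i : ℝ) + 1) * Real.pi
  rw [← Real.sqrt_eq_rpow, Real.norm_of_nonneg (Real.sqrt_nonneg _), Real.norm_of_nonneg (by linarith)]
  refine Real.sqrt_le_iff.2 ⟨by positivity, ?_⟩
  have : 1 ≤ w ^ 2 := by nlinarith
  nlinarith [mul_nonneg hK0 (sub_nonneg.2 this), mul_nonneg (sq_nonneg K) (sq_nonneg w)]

include hk hlam in
theorem odd_mul_pi_inv_isBigO : (fun i => ((2 * (k i : ℝ) + 1) * Real.pi)⁻¹) =O[l]
    fun i => ‖lam i‖ ^ (-(1 / 2) : ℝ) := by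
  have h := (norm_rpow_half_isBigO hk hlam).inv_rev (by
    filter_upwards [(norm_tendsto_atTop hk hlam).eventually_gt_atTop 0] with i hi h0
    exact absurd h0 (Real.rpow_pos_of_pos hi _).ne')
  refine h.congr_right fun i => ?_
  rw [Real.rpow_neg (norm_nonneg _)]

include hk hlam in
theorem complexSqrt_mul_solS_isBigO : (fun i => complexSqrt (lam i) * solS hq 1 (lam i)) =O[l]
    fun i => ‖lam i‖ ^ (-(1 / 2) : ℝ) := by
  have h1 : (fun i => complexSqrt (lam i)) =O[l] fun i => (2 * (k i : ℝ) + 1) * Real.pi :=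
    IsBigO.of_norm_left (by simpa only [norm_complexSqrt] using norm_rpow_half_isBigO hk hlam)
  refine ((h1.mul (solS_isBigO hq hk hlam)).congr' EventuallyEq.rfl ?_).trans
    (odd_mul_pi_inv_isBigO hk hlam)
  filter_upwards [(tendsto_odd_mul_pi_atTop hk).eventually_gt_atTop 0] with i hi
  field_simp

include hk hlam in
theorem complexSqrt_inv_mul_solC'_isLittleO :
    (fun i => 1 / complexSqrt (lam i) * solC' hq 1 (lam i)) =o[l] fun _ => (1 : ℝ) := by
  have h1 : (fun i => 1 / complexSqrt (lam i)) =o[l] fun _ => (1 : ℝ) := by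
    rw [isLittleO_one_iff, tendsto_zero_iff_norm_tendsto_zero]
    refine (((tendsto_rpow_atTop (by norm_num : (0 : ℝ) < 1 / 2)).comp
      (norm_tendsto_atTop hk hlam)).inv_tendsto_atTop).congr fun i => ?_
    simp [norm_complexSqrt]
  simpa using h1.mul_isBigO (solC'_isBigO_one hq hk hlam)

end Asymptotics

/-! ### Small perturbations of determinants -/

section Perturbation

variable {ι : Type*} {l : Filter ι} {g : ι → ℝ}

/-- Induction on ab - a'b' = (a - a')b + a'(b - b'). Boundedness of the product of the X's is
carried along; that of the Y's follows because g is bounded. -/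
theorem prod_sub_prod_isLittleO {α : Type*} (s : Finset α) {X Y : α → ι → ℂ}
    (hX : ∀ a, X a =O[l] fun _ => (1 : ℝ)) (h : ∀ a, (fun i => Y a i - X a i) =o[l] g)
    (hg : g =O[l] fun _ => (1 : ℝ)) :
    (fun i => ∏ a ∈ s, Y a i - ∏ a ∈ s, X a i) =o[l] g ∧
      (fun i => ∏ a ∈ s, X a i) =O[l] fun _ => (1 : ℝ) := by
  classical
  induction s using Finset.induction_on with
  | empty => exact ⟨by simp, by
      simpa using isBigO_const_const (1 : ℂ) (one_ne_zero (α := ℝ)) l⟩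
  | insert a s ha ih =>
    obtain ⟨h1, h2⟩ := ih
    have h3 : (fun i => ∏ b ∈ s, Y b i) =O[l] fun _ => (1 : ℝ) :=
      ((h1.isBigO.trans hg).add h2).congr_left fun i => by ring
    have h4 := (h a).mul_isBigO h3
    have h5 := (hX a).mul_isLittleO h1
    simp only [mul_one, one_mul] at h4 h5
    refine ⟨(h4.add h5).congr_left fun i => ?_, ?_⟩
    · rw [Finset.prod_insert ha, Finset.prod_insert ha]; ring
    · simpa [Finset.prod_insert ha] using (hX a).mul h2

/-- A perturbation of size `o(g)` of the entries of a bounded matrix changes the determinant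
by `o(g)`. -/
theorem det_sub_det_isLittleO {m : Type*} [Fintype m] [DecidableEq m] {X Y : ι → Matrix m m ℂ}
    (hX : ∀ a b, (fun i => X i a b) =O[l] fun _ => (1 : ℝ))
    (h : ∀ a b, (fun i => Y i a b - X i a b) =o[l] g) (hg : g =O[l] fun _ => (1 : ℝ)) :
    (fun i => (Y i).det - (X i).det) =o[l] g := by
  have key : ∀ σ : Equiv.Perm m, (fun i => ((Equiv.Perm.sign σ : ℤ) : ℂ) *
      (∏ a, Y i (σ a) a - ∏ a, X i (σ a) a)) =o[l] g := fun σ =>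
    (prod_sub_prod_isLittleO Finset.univ (fun a => hX (σ a) a)
      (fun a => h (σ a) a) hg).1.const_mul_left _
  refine (IsLittleO.fun_sum fun σ (_ : σ ∈ Finset.univ) => key σ).congr_left fun i => ?_
  simp only [Matrix.det_apply', ← Finset.sum_sub_distrib, ← mul_sub]

end Perturbation

/-! ### Expansions of block determinants -/

namespace Matrix

variable {R : Type*} [CommRing R]

/-- Multilinearity in the rows: S records the rows taken from A. The other rows are diagonal, so the
resulting matrix is block triangular. -/
theorem det_add_diagonal {m : Type*} [Fintype m] [DecidableEq m] (A : Matrix m m R) (d : m → R) :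
    (A + diagonal d).det = ∑ S : Finset m,
      (∏ a with a ∉ S, d a) * (A.submatrix ((↑) : S → m) ((↑) : S → m)).det := by
  have h := (detRowAlternating (R := R) (n := m)).toMultilinearMap.map_add_univ
    (fun i => A i) (fun i => diagonal d i)
  change (detRowAlternating (R := R) (n := m)) (A + diagonal d) = _ 
  refine h.trans (Finset.sum_congr rfl fun S _ => ?_)
  set P : Matrix m m R := of (S.piecewise (fun i => A i) (fun i => diagonal d i)) with hP
  change P.det = _
  rw [twoBlockTriangular_det _ (· ∈ S)]
  · rw [mul_comm]
    congr 1
    · have : P.toSquareBlockProp (· ∉ S) =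
          diagonal fun a : {a // a ∉ S} => d a := by
        ext i j
        by_cases hij : i = j
        · subst hij; simp [toSquareBlockProp, hP, i.2]
        · have : (i : m) ≠ j := fun h => hij (Subtype.ext h)
          simp [toSquareBlockProp, hP, i.2, hij, this]
      rw [this, det_diagonal]
      exact (Finset.prod_subtype _ (by simp) _).symm
    · have : A.submatrix ((↑) : S → m) ((↑) : S → m) = (P.toSquareBlockProp (· ∈ S)).submatrix
          (Equiv.refl {a // a ∈ S}) (Equiv.refl {a // a ∈ S}) := by
        ext i j
        simp [toSquareBlockProp, hP, i.2]
      rw [this, det_submatrix_equiv_self]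
      congr!
  · intro i hi j hj
    have : i ≠ j := fun h => hi (h ▸ hj)
    simp [hP, hi, this]

variable {V E : Type*} [Fintype V] [Fintype E] [DecidableEq V] [DecidableEq E]

theorem det_fromBlocks_zero_diagonal (B : Matrix V E R) (C : Matrix E V R) (d : E → R) :
    (fromBlocks 0 B C (diagonal d)).det = ∑ τ : Finset E, (∏ e with e ∉ τ, d e) *
      (fromBlocks 0 (B.submatrix id ((↑) : τ → E)) (C.submatrix ((↑) : τ → E) id) 0).det := by
  have h0 : fromBlocks 0 B C (diagonal d) =
      fromBlocks 0 B C 0 + diagonal (Sum.elim (fun _ : V => 0) d) := by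
    ext (i | i) (j | j) <;> simp [diagonal_apply]
  rw [h0, det_add_diagonal]
  symm
  refine Finset.sum_of_injOn (fun τ => Finset.univ.disjSum τ) ?_ (by simp) ?_ ?_
  · intro τ _ τ' _ h
    ext e
    have := Finset.ext_iff.1 h (Sum.inr e)
    simpa using this
  · intro S _ hS
    -- The added diagonal is zero on `V`, so only sets containing every vertex contribute.
    have : ∃ v : V, Sum.inl v ∉ S := by
      by_contra! hv
      refine hS ⟨S.toRight, by simp, ?_⟩
      ext (v | e)
      · simp [hv]
      · simp
    obtain ⟨v, hv⟩ := this
    rw [Finset.prod_eq_zero (i := Sum.inl v) (by simp [hv]) (by simp), zero_mul]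
  · intro τ _
    congr 1
    · simp only [Finset.prod_filter]
      rw [Fintype.prod_sum_type]
      simp
    · let φ : V ⊕ τ → (Finset.univ.disjSum τ : Finset (V ⊕ E)) := fun x =>
        ⟨Sum.map id Subtype.val x, by rcases x with x | x <;> simp⟩
      have hφ : Function.Bijective φ := by
        constructor
        · intro a b h
          exact (Function.injective_id.sumMap Subtype.val_injective) (congrArg Subtype.val h)
        · rintro ⟨(a | a), ha⟩
          · exact ⟨Sum.inl a, rfl⟩
          · exact ⟨Sum.inr ⟨a, by simpa using ha⟩, rfl⟩
      rw [← det_submatrix_equiv_self (Equiv.ofBijective φ hφ)]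
      congr 1
      ext (i | i) (j | j) <;> rfl

theorem det_fromBlocks_zero_zero (B : Matrix V E R) (C : Matrix E V R) (φ : V ≃ E) :
    (fromBlocks 0 B C 0).det =
      (-1) ^ Fintype.card V * ((B.submatrix id φ).det * (C.submatrix φ id).det) := by
  have h1 : (fromBlocks 0 B C 0).det =
      (fromBlocks (0 : Matrix V V R) (B.submatrix id φ) (C.submatrix φ id) 0).det := by
    rw [← det_submatrix_equiv_self ((Equiv.refl V).sumCongr φ)]
    congr 1
    ext (i | i) (j | j) <;> rfl
  have h2 : fromBlocks (0 : Matrix V V R) (B.submatrix id φ) (C.submatrix φ id) 0 =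
      fromBlocks (B.submatrix id φ) 0 0 (C.submatrix φ id) * fromBlocks 0 1 1 0 := by
    simp [fromBlocks_multiply]
  -- The block swap has determinant (-1)^|V|: a unipotent factor turns it into a matrix with
  -- identity corner, whose Schur complement is -1.
  have h3 : fromBlocks (1 : Matrix V V R) (1 : Matrix V V R) 0 (1 : Matrix V V R) *
      fromBlocks 0 1 1 0 =
      fromBlocks (1 : Matrix V V R) (1 : Matrix V V R) (1 : Matrix V V R) 0 := by
    simp [fromBlocks_multiply]
  have h4 := congrArg det h3
  rw [det_mul, det_fromBlocks_zero₂₁, det_fromBlocks_one₁₁] at h4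
  simp only [det_one, one_mul, mul_one, zero_sub, det_neg] at h4
  rw [h1, h2, det_mul, det_fromBlocks_zero₂₁, h4]
  ring

/-- If B or C has more columns than rows, a kernel vector of it, extended by zero, is killed by the
whole matrix. -/
theorem card_eq_of_det_fromBlocks_zero_zero_ne_zero {K : Type*} [Field K] (B : Matrix V E K)
    (C : Matrix E V K) (h : (fromBlocks 0 B C 0).det ≠ 0) : Fintype.card V = Fintype.card E := by
  rcases lt_trichotomy (Fintype.card V) (Fintype.card E) with hlt | heq | hlt
  · exfalso
    have := LinearMap.ker_ne_bot_of_finrank_lt (f := B.mulVecLin) (by simpa using hlt)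
    obtain ⟨z, hz, hz0⟩ := Submodule.exists_mem_ne_zero_of_ne_bot this
    refine h (exists_mulVec_eq_zero_iff.1 ⟨Sum.elim 0 z, fun h0 => hz0 ?_, ?_⟩)
    · ext e; exact congrFun h0 (Sum.inr e)
    · have : B *ᵥ z = 0 := by simpa using hz
      rw [fromBlocks_mulVec]
      ext (i | i) <;> simp [this]
  · exact heq
  · exfalso
    have := LinearMap.ker_ne_bot_of_finrank_lt (f := C.mulVecLin) (by simpa using hlt)
    obtain ⟨z, hz, hz0⟩ := Submodule.exists_mem_ne_zero_of_ne_bot this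
    refine h (exists_mulVec_eq_zero_iff.1 ⟨Sum.elim z 0, fun h0 => hz0 ?_, ?_⟩)
    · ext e; exact congrFun h0 (Sum.inl e)
    · have : C *ᵥ z = 0 := by simpa using hz
      rw [fromBlocks_mulVec]
      ext (i | i) <;> simp [this]

/-- Scaling the rows of the first block by `s` and the columns of the second block by `t`. -/
theorem det_fromBlocks_smul (A : Matrix V V R) (B : Matrix V E R) (C : Matrix E V R)
    (D : Matrix E E R) {s t : R} (hst : s * t = 1) :
    (fromBlocks (s • A) B C (t • D)).det =
      s ^ Fintype.card V * t ^ Fintype.card E * (fromBlocks A B C D).det := by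
  -- The block `B` is scaled by both factors and is unchanged because `s * t = 1`; `C` is touched by
  -- neither.
  have h : fromBlocks (s • A) B C (t • D) =
      fromBlocks (s • (1 : Matrix V V R)) 0 0 1 * fromBlocks A B C D *
        fromBlocks 1 0 0 (t • (1 : Matrix E E R)) := by
    simp [fromBlocks_multiply, smul_smul, mul_comm t s, hst]
  rw [h, det_mul, det_mul, det_fromBlocks_zero₂₁, det_fromBlocks_zero₂₁]
  simp only [det_smul, det_one]
  ring

end Matrix

/-! ### Cycles and reachability in multigraphs -/

theorem Fin.ofNat_add_one_eq (n m : ℕ) : Fin.ofNat (n + 1) (m + 1) = Fin.ofNat (n + 1) m + 1 := by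
  ext; simp [Fin.val_add]

theorem Fin.cyclic_induction {n : ℕ} {P : Fin (n + 1) → Prop} (h0 : P 0)
    (h : ∀ i, P i → P (i + 1)) (i : Fin (n + 1)) : P i := by
  have key : ∀ m : ℕ, P (Fin.ofNat (n + 1) m) := fun m => by
    induction m with
    | zero => simpa using h0
    | succ m ih => rw [Fin.ofNat_add_one_eq]; exact h _ ih
  simpa using key i

namespace OrientedMultigraph

section Combinatorics

variable {V E : Type*} {Γ : OrientedMultigraph V E} {τ γ : Finset E}

theorem Joins.symm {e : E} {u v : V} (h : Γ.Joins e u v) : Γ.Joins e v u := Or.symm h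

theorem joins_src_tgt (e : E) : Γ.Joins e (Γ.src e) (Γ.tgt e) := Or.inl ⟨rfl, rfl⟩

theorem Joins.eq_or_eq {e : E} {u v u' v' : V} (h : Γ.Joins e u v) (h' : Γ.Joins e u' v') :
    (u = u' ∧ v = v') ∨ (u = v' ∧ v = u') := by
  unfold Joins at h h'
  aesop

theorem Joins.reachable {e : E} {u v : V} (h : Γ.Joins e u v) (he : e ∈ τ) :
    (Γ.spanningGraph τ).Reachable u v := by
  by_cases huv : u = v
  · subst huv; rfl
  · exact SimpleGraph.Adj.reachable ⟨huv, Or.inl ⟨e, he, h⟩⟩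

theorem exists_joins_of_adj {u v : V} (h : (Γ.spanningGraph τ).Adj u v) :
    ∃ e ∈ τ, Γ.Joins e u v := by
  obtain ⟨-, ⟨e, he, h⟩ | ⟨e, he, h⟩⟩ := h
  exacts [⟨e, he, h⟩, ⟨e, he, h.symm⟩]

/-- Reachability is the smallest reflexive and transitive relation that holds for the ends of
the edges. -/
theorem rel_of_reachable {r : V → V → Prop} (hrefl : ∀ a, r a a)
    (htrans : ∀ a b c, r a b → r b c → r a c)
    (hr : ∀ e ∈ τ, ∀ a b, Γ.Joins e a b → r a b) {a b : V}
    (h : (Γ.spanningGraph τ).Reachable a b) : r a b := by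
  rw [SimpleGraph.reachable_iff_reflTransGen] at h
  induction h with
  | refl => exact hrefl a
  | tail _ hbc ih =>
    obtain ⟨e, he, hj⟩ := exists_joins_of_adj hbc
    exact htrans _ _ _ ih (hr e he _ _ hj)

theorem spanningGraph_mono {τ' : Finset E} (h : τ ⊆ τ') : Γ.spanningGraph τ ≤ Γ.spanningGraph τ' := by
  intro u v huv
  obtain ⟨e, he, hj⟩ := exists_joins_of_adj huv
  exact ⟨huv.ne, Or.inl ⟨e, h he, hj⟩⟩

theorem IsCycle.nonempty (h : Γ.IsCycle γ) : γ.Nonempty := by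
  obtain ⟨n, v, f, -, -, -, hγ⟩ := h
  exact ⟨f 0, by rw [← Finset.mem_coe, hγ]; exact mem_range_self _⟩

theorem card_of_coe_eq_range {n : ℕ} {f : Fin (n + 1) → E} (hf : Function.Injective f)
    (h : (γ : Set E) = range f) : γ.card = n + 1 := by
  rw [← Set.ncard_coe_finset, h, ← Set.image_univ, Set.ncard_image_of_injective _ hf]
  simp

theorem IsCycle.reachable (h : Γ.IsCycle γ) (hγ : γ ⊆ τ) {e e' : E} (he : e ∈ γ) (he' : e' ∈ γ) :
    (Γ.spanningGraph τ).Reachable (Γ.src e) (Γ.src e') := by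
  obtain ⟨n, v, f, -, -, hj, hr⟩ := h
  have hmem : ∀ i, f i ∈ τ := fun i => hγ (by rw [← Finset.mem_coe, hr]; exact mem_range_self _)
  have h1 : ∀ i, (Γ.spanningGraph τ).Reachable (v 0) (v i) := Fin.cyclic_induction (by rfl)
    fun i hi => hi.trans ((hj i).reachable (hmem i))
  have h2 : ∀ e ∈ γ, (Γ.spanningGraph τ).Reachable (v 0) (Γ.src e) := fun e he => by
    rw [← Finset.mem_coe, hr] at he
    obtain ⟨i, rfl⟩ := he
    rcases (hj i).eq_or_eq (joins_src_tgt (f i)) with h | h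
    · exact h.1 ▸ h1 i
    · exact h.2 ▸ h1 (i + 1)
  exact (h2 e he).symm.trans (h2 e' he')

/-- An edge joining two vertices that are connected by other edges lies on a cycle. -/
theorem exists_isCycle_of_reachable [DecidableEq E] {e : E} (he : e ∉ τ) {a b : V}
    (hab : (Γ.spanningGraph τ).Reachable a b) (hj : Γ.Joins e b a) :
    ∃ γ ⊆ insert e τ, Γ.IsCycle γ := by
  classical
  obtain ⟨p, hp⟩ := hab.exists_isPath
  set n := p.length with hn
  have hinj : ∀ i j : ℕ, i ≤ n → j ≤ n → p.getVert i = p.getVert j → i = j :=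
    fun i j hi hj h => hp.getVert_injOn hi hj h
  have hadj : ∀ i : ℕ, i < n → ∃ e ∈ τ, Γ.Joins e (p.getVert i) (p.getVert (i + 1)) :=
    fun i hi => exists_joins_of_adj (p.adj_getVert_succ hi)
  choose g hgτ hg using hadj
  -- The path supplies the first n edges and e closes it up. For a = b the path is empty and e is a
  -- loop.
  let f : Fin (n + 1) → E := fun i => if h : (i : ℕ) < n then g i h else e
  have hf1 : ∀ (i : Fin (n + 1)) (h : (i : ℕ) < n), f i = g i h := fun i h => dif_pos h
  have hf2 : ∀ (i : Fin (n + 1)), ¬ (i : ℕ) < n → f i = e := fun i h => dif_neg h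
  refine ⟨Finset.univ.image f, ?_, n, fun i => p.getVert i, f, ?_, ?_, ?_, by simp⟩
  · intro x hx
    obtain ⟨i, -, rfl⟩ := Finset.mem_image.1 hx
    by_cases hi : (i : ℕ) < n
    · rw [hf1 i hi]; exact Finset.mem_insert_of_mem (hgτ _ _)
    · rw [hf2 i hi]; exact Finset.mem_insert_self _ _
  · intro i j h
    exact Fin.ext (hinj i j (by omega) (by omega) h)
  · intro i j h
    by_cases hi : (i : ℕ) < n <;> by_cases hj : (j : ℕ) < n
    · rw [hf1 i hi, hf1 j hj] at h
      have h1 := hg i hi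
      rw [h] at h1
      rcases h1.eq_or_eq (hg j hj) with h2 | h2
      · exact Fin.ext (hinj i j (by omega) (by omega) h2.1)
      -- Opposite traversal of one edge would force both i = j + 1 and i + 1 = j.
      · have := hinj _ _ (by omega) (by omega) h2.1
        have := hinj _ _ (by omega) (by omega) h2.2
        omega
    · rw [hf1 i hi, hf2 j hj] at h
      exact absurd (h ▸ hgτ i hi) he
    · rw [hf2 i hi, hf1 j hj] at h
      exact absurd (h ▸ hgτ j hj) he
    · exact Fin.ext (by omega)
  · intro i
    by_cases hi : (i : ℕ) < n
    · rw [hf1 i hi]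
      have : ((i + 1 : Fin (n + 1)) : ℕ) = i + 1 :=
        Fin.val_add_one_of_lt (Fin.lt_last_iff_ne_last.2 fun h => by simp [h] at hi)
      simp only [this]
      exact hg i hi
    · rw [hf2 i hi]
      have h1 : i = Fin.last n := Fin.ext (by simp; omega)
      subst h1
      simpa [hn] using hj

/-! ### Counting edges of saturated forests -/

section Counting

variable [Fintype V]

theorem numComponents_le_of_subset {τ' : Finset E} (h : τ ⊆ τ') :
    Γ.numComponents τ' ≤ Γ.numComponents τ := by
  classical
  exact Nat.card_le_card_of_surjective _
    (SimpleGraph.ConnectedComponent.surjective_map_ofLE (spanningGraph_mono h))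

/-- Each edge added without closing a cycle merges two components: had its ends been connected
already, it would lie on a cycle. -/
theorem card_add_numComponents_le [DecidableEq E] (h : ∀ γ ⊆ τ, ¬ Γ.IsCycle γ) :
    τ.card + Γ.numComponents τ ≤ Fintype.card V := by
  classical
  induction τ using Finset.induction_on with
  | empty =>
    rw [Finset.card_empty, zero_add, ← Nat.card_eq_fintype_card]
    exact Nat.card_le_card_of_surjective (Γ.spanningGraph ∅).connectedComponentMk Quot.mk_surjective
  | insert e τ he ih =>
    have h1 := ih fun γ hγ => h γ (hγ.trans (Finset.subset_insert _ _))
    have h2 : Γ.numComponents (insert e τ) < Γ.numComponents τ := by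
      unfold numComponents
      rw [Nat.card_eq_fintype_card, Nat.card_eq_fintype_card]
      refine Fintype.card_lt_of_surjective_not_injective _
        (SimpleGraph.ConnectedComponent.surjective_map_ofLE
          (spanningGraph_mono (Γ := Γ) (Finset.subset_insert e τ))) fun hinj => ?_
      have h3 : (Γ.spanningGraph τ).Reachable (Γ.src e) (Γ.tgt e) := by
        rw [← SimpleGraph.ConnectedComponent.eq]
        apply hinj
        exact SimpleGraph.ConnectedComponent.eq.2
          ((joins_src_tgt e).reachable (Finset.mem_insert_self e τ))
      obtain ⟨γ, hγ, hc⟩ := exists_isCycle_of_reachable he h3 (joins_src_tgt e).symm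
      exact h γ hγ hc
    rw [Finset.card_insert_of_notMem he]
    omega

/-- Removing one edge from the cycle of each component leaves no cycle. This deletes exactly κ(τ)
edges and cannot lower the number of components, so the bound for acyclic sets applies. -/
theorem IsSaturatedForest.card_le (h : Γ.IsSaturatedForest τ) : τ.card ≤ Fintype.card V := by
  classical
  choose c hc hu using h
  have hne : ∀ K, ∃ e, e ∈ c K := fun K => (hc K).2.1.nonempty
  choose r hr using hne
  have hrinj : Function.Injective r := fun K K' hK => by
    rw [← (hc K).2.2 _ (hr K), ← (hc K').2.2 _ (hr K'), hK]
  set R : Finset E := Finset.univ.image r with hR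
  have hRτ : R ⊆ τ := fun e he => by
    obtain ⟨K, -, rfl⟩ := Finset.mem_image.1 he
    exact (hc K).1 (hr K)
  have hRc : R.card = Γ.numComponents τ := by
    rw [hR, Finset.card_image_of_injective _ hrinj, Finset.card_univ, ← Nat.card_eq_fintype_card]
    rfl
  have hac : ∀ γ ⊆ τ \ R, ¬ Γ.IsCycle γ := by
    intro γ hγ hcyc
    have hγτ := hγ.trans Finset.sdiff_subset
    obtain ⟨e, he⟩ := hcyc.nonempty
    have := hu ((Γ.spanningGraph τ).connectedComponentMk (Γ.src e)) γ ⟨hγτ, hcyc, fun e' he' =>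
      SimpleGraph.ConnectedComponent.eq.2 (hcyc.reachable hγτ he' he)⟩
    have h1 := hr ((Γ.spanningGraph τ).connectedComponentMk (Γ.src e))
    rw [← this] at h1
    exact (Finset.mem_sdiff.1 (hγ h1)).2 (Finset.mem_image_of_mem r (Finset.mem_univ _))
  have h1 := card_add_numComponents_le hac
  have h2 := numComponents_le_of_subset (Γ := Γ) (Finset.sdiff_subset (s := τ) (t := R))
  have h3 := Finset.card_sdiff_add_card_eq_card hRτ
  omega

end Counting

/-! ### Labels that are opposite along edges -/

section Labelling

variable {A : Type*} [AddCommGroup A] {w : V → A}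

/-- Labels that are opposite at the ends of every edge are 2-torsion on odd cycles. -/
theorem IsCycle.add_self_eq_zero (h : Γ.IsCycle γ) (hodd : Odd γ.card)
    (hw : ∀ e ∈ γ, w (Γ.src e) + w (Γ.tgt e) = 0) {e : E} (he : e ∈ γ) :
    w (Γ.src e) + w (Γ.src e) = 0 := by
  obtain ⟨n, v, f, hv, hf, hj, hr⟩ := h
  have hmem : ∀ i, f i ∈ γ := fun i => by rw [← Finset.mem_coe, hr]; exact mem_range_self _
  have hstep : ∀ i, w (v (i + 1)) = -w (v i) := fun i => by
    have := hw _ (hmem i)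
    rw [eq_neg_iff_add_eq_zero]
    rcases hj i with ⟨h1, h2⟩ | ⟨h1, h2⟩
    · rw [← h1, ← h2, add_comm]; exact this
    · rw [← h1, ← h2]; exact this
  have hpow : ∀ m : ℕ, w (v (Fin.ofNat (n + 1) m)) = (-1 : ℤ) ^ m • w (v 0) := fun m => by
    induction m with
    | zero => simp
    | succ m ih => rw [Fin.ofNat_add_one_eq, hstep, ih, pow_succ]; simp
  have h0 : w (v 0) + w (v 0) = 0 := by
    have := hpow (n + 1)
    rw [card_of_coe_eq_range hf hr] at hodd
    rw [hodd.neg_one_pow] at this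
    rw [show Fin.ofNat (n + 1) (n + 1) = 0 by ext; simp] at this
    nth_rewrite 1 [this]
    simp
  have hall : ∀ i, w (v i) + w (v i) = 0 := Fin.cyclic_induction h0 fun i hi => by
    rw [hstep, ← neg_add, hi, neg_zero]
  rw [← Finset.mem_coe, hr] at he
  obtain ⟨i, rfl⟩ := he
  rcases (hj i).eq_or_eq (joins_src_tgt (f i)) with h | h
  · exact h.1 ▸ hall i
  · exact h.2 ▸ hall (i + 1)

/-- Crossing an edge negates the label, and negation fixes 2-torsion elements. -/
theorem eq_of_reachable_of_add_self_eq_zero (hw : ∀ e ∈ τ, w (Γ.src e) + w (Γ.tgt e) = 0) {a b : V}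
    (hab : (Γ.spanningGraph τ).Reachable a b) : w a + w a = 0 → w b = w a := by
  refine rel_of_reachable (r := fun a b => w a + w a = 0 → w b = w a) (fun _ _ => rfl)
    (fun a b c h1 h2 h => ?_) (fun e he a b hj h => ?_) hab
  · rw [h2 (by rw [h1 h, h]), h1 h]
  · have h2 : w a + w b = 0 := by
      have := hw e he
      rcases hj with ⟨h1, h2⟩ | ⟨h1, h2⟩
      · rwa [h1, h2] at this
      · rwa [h1, h2, add_comm] at this
    exact add_left_cancel (h2.trans h.symm)

theorem IsOddSaturatedForest.add_self_eq_zero (h : Γ.IsOddSaturatedForest τ)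
    (hw : ∀ e ∈ τ, w (Γ.src e) + w (Γ.tgt e) = 0) (v : V) : w v + w v = 0 := by
  obtain ⟨γ, ⟨h1, h2, h3⟩, -⟩ := h.1 ((Γ.spanningGraph τ).connectedComponentMk v)
  obtain ⟨e, he⟩ := h2.nonempty
  have h4 := h2.add_self_eq_zero (h.2 γ h1 h2) (fun e he => hw e (h1 he)) he
  rw [eq_of_reachable_of_add_self_eq_zero hw (SimpleGraph.ConnectedComponent.eq.1 (h3 e he)) h4, h4]

end Labelling

/-- The unoriented incidence matrix, in which loops count twice. -/
def incidence (Γ : OrientedMultigraph V E) (R : Type*) [Ring R] [DecidableEq V] : Matrix V E R :=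
  fun v e => (if Γ.tgt e = v then 1 else 0) + (if Γ.src e = v then 1 else 0)

theorem incidence_col [DecidableEq V] (e : E) : (fun v => Γ.incidence ℤ v e) =
    Pi.single (Γ.src e) 1 + Pi.single (Γ.tgt e) 1 := by
  ext v
  simp [incidence, Pi.single_apply, add_comm, eq_comm]

/-! ### The incidence minor of an odd saturated forest -/

section Determinant

variable [Fintype V] [DecidableEq V]

/-- Left kernel vectors of the incidence matrix are thus labels that are opposite along edges. -/
theorem vecMul_incidence {R : Type*} [Ring R] (z : V → R) (e : E) :
    ∑ v, z v * Γ.incidence R v e = z (Γ.src e) + z (Γ.tgt e) := by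
  simp [incidence, mul_add, Finset.sum_add_distrib, add_comm]

/-- With fewer edges than vertices there would be a nonzero rational label opposite along edges; it
would be 2-torsion, hence zero. -/
theorem IsOddSaturatedForest.card_eq (h : Γ.IsOddSaturatedForest τ) :
    τ.card = Fintype.card V := by
  refine le_antisymm h.1.card_le ?_
  by_contra! hlt
  have := LinearMap.ker_ne_bot_of_finrank_lt
    (f := ((Γ.incidence ℚ).submatrix id ((↑) : τ → E)).vecMulLinear) (by simpa using hlt)
  obtain ⟨z, hz, hz0⟩ := Submodule.exists_mem_ne_zero_of_ne_bot this
  refine hz0 (funext fun v => ?_)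
  have := h.add_self_eq_zero (w := z) (fun e he => ?_) v
  · simpa using this
  · rw [← vecMul_incidence]
    have := congrFun (LinearMap.mem_ker.1 hz) ⟨e, he⟩
    simpa [Matrix.vecMul, dotProduct] using this

theorem IsOddSaturatedForest.det_ne_zero (h : Γ.IsOddSaturatedForest τ) (φ : V ≃ τ) :
    ((Γ.incidence ℤ).submatrix id (fun u => (φ u : E))).det ≠ 0 := by
  intro h0
  obtain ⟨z, hz0, hz⟩ := Matrix.exists_vecMul_eq_zero_iff.2 h0
  refine hz0 (funext fun v => ?_)
  have := h.add_self_eq_zero (w := z) (fun e he => ?_) v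
  · simpa using this
  · rw [← vecMul_incidence]
    have := congrFun hz (φ.symm ⟨e, he⟩)
    simpa [Matrix.vecMul, dotProduct] using this

open scoped Classical in
/-- The map that sums labels over each connected component, modulo 2. -/
noncomputable def componentSum (Γ : OrientedMultigraph V E) (τ : Finset E) :
    (V → ℤ) →ₗ[ℤ] ((Γ.spanningGraph τ).ConnectedComponent → ZMod 2) where
  toFun x K := ∑ v with (Γ.spanningGraph τ).connectedComponentMk v = K, (x v : ZMod 2)
  map_add' x y := by ext K; simp [Finset.sum_add_distrib]
  map_smul' c x := by ext K; simp [Finset.mul_sum]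

open scoped Classical in
theorem componentSum_single (v : V) : componentSum Γ τ (Pi.single v 1) =
    Pi.single ((Γ.spanningGraph τ).connectedComponentMk v) 1 := by
  ext K
  simp only [componentSum, LinearMap.coe_mk, AddHom.coe_mk, Pi.single_apply, Int.cast_ite,
    Int.cast_one, Int.cast_zero, Finset.sum_ite_eq', Finset.mem_filter, Finset.mem_univ, true_and]
  exact if_congr eq_comm rfl rfl

theorem componentSum_surjective : Function.Surjective (componentSum Γ τ) := by
  classical
  intro y
  refine ⟨∑ K, ((y K).val : ℤ) • Pi.single K.out 1, ?_⟩
  rw [map_sum]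
  ext K
  simp only [map_smul, componentSum_single, Finset.sum_apply, Pi.smul_apply]
  rw [Finset.sum_eq_single K]
  · have : (Γ.spanningGraph τ).connectedComponentMk K.out = K := Quot.out_eq K
    simp [this]
  · intro K' _ hK
    have : (Γ.spanningGraph τ).connectedComponentMk K'.out = K' := Quot.out_eq K'
    simp [this, hK.symm]
  · simp

/-- Modulo the column lattice L, the classes of basis vectors are labels opposite along edges, hence
2-torsion and constant on components. An x with even component sums therefore has class zero.
Conversely, a column adds two units to a single component. -/
theorem IsOddSaturatedForest.ker_componentSum (h : Γ.IsOddSaturatedForest τ) (φ : V ≃ τ) :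
    LinearMap.ker (componentSum Γ τ) =
      LinearMap.range ((Γ.incidence ℤ).submatrix id (fun u => (φ u : E))).mulVecLin := by
  classical
  set L := LinearMap.range ((Γ.incidence ℤ).submatrix id (fun u => (φ u : E))).mulVecLin with hL
  have hcol : ∀ e ∈ τ, (Pi.single (Γ.src e) 1 + Pi.single (Γ.tgt e) 1 : V → ℤ) ∈ L := fun e he => by
    rw [hL, Matrix.range_mulVecLin, ← incidence_col]
    refine Submodule.subset_span ⟨φ.symm ⟨e, he⟩, ?_⟩
    ext v; simp [Matrix.col]
  apply le_antisymm
  · intro x hx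
    set w : V → (V → ℤ) ⧸ L := fun v => L.mkQ (Pi.single v 1) with hw
    have hw1 : ∀ e ∈ τ, w (Γ.src e) + w (Γ.tgt e) = 0 := fun e he => by
      rw [hw, ← map_add]
      exact (Submodule.Quotient.mk_eq_zero L).2 (hcol e he)
    have h2 := h.add_self_eq_zero hw1
    have hrep : ∀ v, w v = w ((Γ.spanningGraph τ).connectedComponentMk v).out := fun v =>
      eq_of_reachable_of_add_self_eq_zero hw1 (SimpleGraph.ConnectedComponent.eq.1
        (Quot.out_eq ((Γ.spanningGraph τ).connectedComponentMk v))) (h2 _)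
    have hx1 : L.mkQ x = ∑ v, x v • w v := by
      conv_lhs => rw [pi_eq_sum_univ' x]
      rw [map_sum]
      refine Finset.sum_congr rfl fun v _ => ?_
      rw [map_smul, hw]
    rw [← Submodule.ker_mkQ L, LinearMap.mem_ker, hx1,
      ← Finset.sum_fiberwise Finset.univ (Γ.spanningGraph τ).connectedComponentMk]
    refine Finset.sum_eq_zero fun K _ => ?_
    have h3 : ∀ v ∈ Finset.univ.filter (fun v => (Γ.spanningGraph τ).connectedComponentMk v = K),
        x v • w v = x v • w K.out := fun v hv => by
      rw [hrep v, (Finset.mem_filter.1 hv).2]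
    rw [Finset.sum_congr rfl h3, ← Finset.sum_smul]
    have h4 := congrFun (LinearMap.mem_ker.1 hx) K
    simp only [componentSum, LinearMap.coe_mk, AddHom.coe_mk, Pi.zero_apply] at h4
    rw [← Int.cast_sum, ZMod.intCast_zmod_eq_zero_iff_dvd] at h4
    obtain ⟨c, hc⟩ := h4
    rw [hc, mul_comm, mul_smul]
    simp [two_smul, h2]
  · rw [hL, Matrix.range_mulVecLin, Submodule.span_le]
    rintro _ ⟨u, rfl⟩
    have : ((Γ.incidence ℤ).submatrix id (fun u => (φ u : E))).col u =
        Pi.single (Γ.src (φ u)) 1 + Pi.single (Γ.tgt (φ u)) 1 := by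
      rw [← incidence_col]; rfl
    rw [this, SetLike.mem_coe, LinearMap.mem_ker, map_add, componentSum_single, componentSum_single,
      SimpleGraph.ConnectedComponent.eq.2 ((joins_src_tgt (Γ := Γ) (φ u : E)).reachable (φ u).2)]
    ext K
    exact CharTwo.add_self_eq_zero _

/-- The absolute value of the determinant is the index of the column lattice, and the component sums
identify the quotient with (ℤ/2)^κ. -/
theorem IsOddSaturatedForest.natAbs_det (h : Γ.IsOddSaturatedForest τ) (φ : V ≃ τ) :
    ((Γ.incidence ℤ).submatrix id (fun u => (φ u : E))).det.natAbs = 2 ^ Γ.numComponents τ := by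
  classical
  set M := (Γ.incidence ℤ).submatrix id (fun u => (φ u : E)) with hM
  have hinj : Function.Injective M.mulVecLin := by
    rw [← LinearMap.ker_eq_bot, Submodule.eq_bot_iff]
    intro z hz
    by_contra hz0
    exact h.det_ne_zero φ (Matrix.exists_mulVec_eq_zero_iff.1 ⟨z, hz0, hz⟩)
  have h1 := Submodule.natAbs_det_equiv (LinearMap.range M.mulVecLin)
    (LinearEquiv.ofInjective M.mulVecLin hinj)
  have h2 : (LinearMap.range M.mulVecLin).subtype ∘ₗ
      AddMonoidHom.toIntLinearMap ((LinearEquiv.ofInjective M.mulVecLin hinj :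
        (V → ℤ) ≃ₗ[ℤ] LinearMap.range M.mulVecLin) : (V → ℤ) →+ LinearMap.range M.mulVecLin) =
      Matrix.toLin' M := by
    ext; rfl
  rw [h2, LinearMap.det_toLin'] at h1
  rw [h1, ← h.ker_componentSum φ,
    Nat.card_congr ((componentSum Γ τ).quotKerEquivOfSurjective componentSum_surjective).toEquiv]
  simp [numComponents]

end Determinant

end Combinatorics

/-! ### Graphs of functions: φ assigns the edge from u to f u -/

section FunctionalGraph

variable {V E : Type*} {Γ : OrientedMultigraph V E} {τ γ : Finset E} {φ : V ≃ τ} {f : V → V}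
  (hf : ∀ u, Γ.Joins (φ u) u (f u))

include hf

/-- Since φ is onto τ, every edge of τ is the one assigned to one of its two ends. -/
theorem eq_of_joins {e : E} (he : e ∈ τ) {a b : V} (h : Γ.Joins e a b) :
    (φ a = ⟨e, he⟩ ∧ f a = b) ∨ (φ b = ⟨e, he⟩ ∧ f b = a) := by
  have h1 := hf (φ.symm ⟨e, he⟩)
  rw [φ.apply_symm_apply] at h1
  rcases h.eq_or_eq h1 with ⟨h2, h3⟩ | ⟨h2, h3⟩
  · left; rw [h2, h3]; simp
  · right; rw [h2, h3]; simp

theorem reachable_iterate (m : ℕ) (u : V) : (Γ.spanningGraph τ).Reachable u (f^[m] u) := by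
  induction m with
  | zero => rfl
  | succ m ih =>
    rw [Function.iterate_succ_apply']
    exact ih.trans ((hf _).reachable (φ _).2)

/-- Having forward orbits that meet is reflexive and transitive, and holds across every edge. -/
theorem exists_iterate_eq_of_reachable {a b : V} (h : (Γ.spanningGraph τ).Reachable a b) :
    ∃ m n : ℕ, f^[m] a = f^[n] b := by
  refine rel_of_reachable (r := fun a b => ∃ m n : ℕ, f^[m] a = f^[n] b) (fun a => ⟨0, 0, rfl⟩)
    ?_ ?_ h
  · rintro a b c ⟨m, n, h1⟩ ⟨m', n', h2⟩
    refine ⟨m' + m, n + n', ?_⟩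
    rw [Function.iterate_add_apply, h1, ← Function.iterate_add_apply, add_comm m',
      Function.iterate_add_apply, h2, ← Function.iterate_add_apply]
  · intro e he a b hj
    rcases eq_of_joins hf he hj with ⟨-, h1⟩ | ⟨-, h1⟩
    · exact ⟨1, 0, h1⟩
    · exact ⟨0, 1, h1.symm⟩

/-- In the graph of a function, every component contains a cycle. -/
theorem exists_isCycle_in_component [Finite V] (x : V) : ∃ γ ⊆ τ, Γ.IsCycle γ ∧
    ∀ e ∈ γ, (Γ.spanningGraph τ).connectedComponentMk (Γ.src e) =
      (Γ.spanningGraph τ).connectedComponentMk x := by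
  classical
  -- By finiteness the orbit of x reaches a periodic point; its orbit is the cycle sought.
  obtain ⟨z, hxz, hz⟩ : ∃ z, (Γ.spanningGraph τ).Reachable x z ∧ z ∈ Function.periodicPts f := by
    obtain ⟨m, n, hmn, h⟩ := Finite.exists_ne_map_eq_of_infinite (fun n : ℕ => f^[n] x)
    wlog hlt : m < n generalizing m n
    · exact this n m hmn.symm h.symm (by omega)
    refine ⟨f^[m] x, reachable_iterate hf m x, Function.mk_mem_periodicPts
      (n := n - m) (by omega) ?_⟩
    change f^[n - m] (f^[m] x) = f^[m] x
    rw [← Function.iterate_add_apply, Nat.sub_add_cancel hlt.le]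
    exact h.symm
  obtain ⟨n, hn⟩ : ∃ n, Function.minimalPeriod f z = n + 1 :=
    ⟨_, (Nat.succ_pred_eq_of_pos (Function.minimalPeriod_pos_of_mem_periodicPts hz)).symm⟩
  let v : Fin (n + 1) → V := fun i => f^[i] z
  have hv : Function.Injective v := fun i j h => Fin.ext
    (Function.iterate_injOn_Iio_minimalPeriod (f := f) (x := z) 
      (by rw [Set.mem_Iio, hn]; exact i.2) (by rw [Set.mem_Iio, hn]; exact j.2) h)
  have hstep : ∀ i, v (i + 1) = f (v i) := fun i => by
    have h1 : ((i + 1 : Fin (n + 1)) : ℕ) = (i + 1) % Function.minimalPeriod f z := by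
      rw [hn, Fin.val_add]; simp
    simp only [v]
    rw [h1, Function.iterate_mod_minimalPeriod_eq, Function.iterate_succ_apply']
  refine ⟨Finset.univ.image fun i => (φ (v i) : E), ?_, ⟨n, v, fun i => φ (v i), hv, ?_, ?_, ?_⟩, ?_⟩
  · intro e he
    obtain ⟨i, -, rfl⟩ := Finset.mem_image.1 he
    exact (φ _).2
  · exact Subtype.val_injective.comp (φ.injective.comp hv)
  · intro i
    rw [hstep]
    exact hf _
  · simp
  · intro e he
    obtain ⟨i, -, rfl⟩ := Finset.mem_image.1 he
    have h1 : (Γ.spanningGraph τ).Reachable x (v i) := hxz.trans (reachable_iterate hf i z)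
    rw [SimpleGraph.ConnectedComponent.eq]
    rcases (hf (v i)).eq_or_eq (joins_src_tgt (φ (v i) : E)) with h | h
    · exact h.1 ▸ h1.symm
    · rw [← h.2]
      exact (h1.trans (reachable_iterate hf 1 _)).symm

/-- In the graph of a function, every cycle is a periodic orbit. -/
theorem IsCycle.exists_invariant (h : Γ.IsCycle γ) (hγ : γ ⊆ τ) :
    ∃ Z : Set V, Z.Nonempty ∧ (∀ z ∈ Z, f z ∈ Z) ∧ (∃ p, 0 < p ∧ ∀ z ∈ Z, f^[p] z = z) ∧
      ∀ e, e ∈ γ ↔ ∃ z ∈ Z, (φ z : E) = e := by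
  obtain ⟨n, v, g, hv, hg, hj, hr⟩ := h
  have hgγ : ∀ i, g i ∈ γ := fun i => by rw [← Finset.mem_coe, hr]; exact mem_range_self _
  have hmem : ∀ e, e ∈ γ ↔ ∃ i, g i = e := fun e => by rw [← Finset.mem_coe, hr]; rfl
  have hcase := fun i => eq_of_joins hf (hγ (hgγ i)) (hj i)
  -- If edge i + 1 is assigned to its initial vertex, then edge i cannot be assigned to that same
  -- vertex unless the two edges coincide. Forward assignment thus propagates backwards around the
  -- cycle, which is traversed entirely along f or entirely against it.
  have hback : ∀ i, (φ (v (i + 1)) = ⟨g (i + 1), hγ (hgγ _)⟩ ∧ f (v (i + 1)) = v (i + 1 + 1)) →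
      (φ (v i) = ⟨g i, hγ (hgγ i)⟩ ∧ f (v i) = v (i + 1)) := fun i hi => by
    rcases hcase i with h | h
    · exact h
    · have h1 : g (i + 1) = g i := congrArg Subtype.val (hi.1.symm.trans h.1)
      have h2 := hg h1
      have h3 := hi
      rw [h2, h2] at h3
      rw [h2]
      exact h3
  have hsurj : ∀ i : Fin (n + 1), ∃ j, j + 1 = i := fun i => ⟨i - 1, by simp⟩
  by_cases hP : ∀ i, φ (v i) = ⟨g i, hγ (hgγ i)⟩ ∧ f (v i) = v (i + 1)
  · refine ⟨range v, range_nonempty v, ?_, ⟨n + 1, n.succ_pos, ?_⟩, fun e => ?_⟩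
    · rintro _ ⟨i, rfl⟩
      exact ⟨i + 1, (hP i).2.symm⟩
    · have : ∀ (m : ℕ) i, f^[m] (v i) = v (i + Fin.ofNat (n + 1) m) := fun m => by
        induction m with
        | zero => intro i; simp
        | succ m ih =>
          intro i
          rw [Function.iterate_succ_apply', ih, (hP _).2, Fin.ofNat_add_one_eq, add_assoc]
      rintro _ ⟨i, rfl⟩
      rw [this, show Fin.ofNat (n + 1) (n + 1) = 0 by ext; simp, add_zero]
    · rw [hmem]
      constructor
      · rintro ⟨i, rfl⟩; exact ⟨v i, mem_range_self i, by rw [(hP i).1]⟩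
      · rintro ⟨_, ⟨i, rfl⟩, rfl⟩; exact ⟨i, by rw [(hP i).1]⟩
  · have hQ : ∀ i, φ (v (i + 1)) = ⟨g i, hγ (hgγ i)⟩ ∧ f (v (i + 1)) = v i := by
      intro i
      refine (hcase i).resolve_left fun hi => hP ?_
      have key : ∀ m : ℕ, φ (v (i - Fin.ofNat (n + 1) m)) =
          ⟨g (i - Fin.ofNat (n + 1) m), hγ (hgγ _)⟩ ∧
          f (v (i - Fin.ofNat (n + 1) m)) = v (i - Fin.ofNat (n + 1) m + 1) := fun m => by
        induction m with
        | zero => simpa using hi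
        | succ m ih =>
          apply hback
          have e : i - Fin.ofNat (n + 1) (m + 1) + 1 = i - Fin.ofNat (n + 1) m := by
            rw [Fin.ofNat_add_one_eq]; abel
          simpa only [e] using ih
      intro j
      have e : i - Fin.ofNat (n + 1) ((i - j : Fin (n + 1)) : ℕ) = j := by simp
      simpa only [e] using key ((i - j : Fin (n + 1)) : ℕ)
    refine ⟨range v, range_nonempty v, ?_, ⟨n + 1, n.succ_pos, ?_⟩, fun e => ?_⟩
    · rintro _ ⟨i, rfl⟩
      obtain ⟨j, rfl⟩ := hsurj i
      exact ⟨j, (hQ j).2.symm⟩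
    · have : ∀ (m : ℕ) i, f^[m] (v (i + Fin.ofNat (n + 1) m)) = v i := fun m => by
        induction m with
        | zero => intro i; simp
        | succ m ih =>
          intro i
          rw [Function.iterate_succ_apply, Fin.ofNat_add_one_eq, ← add_assoc, (hQ _).2, ih]
      rintro _ ⟨i, rfl⟩
      have := this (n + 1) i
      rwa [show Fin.ofNat (n + 1) (n + 1) = 0 by ext; simp, add_zero] at this
    · rw [hmem]
      constructor
      · rintro ⟨i, rfl⟩; exact ⟨v (i + 1), mem_range_self _, by rw [(hQ i).1]⟩
      · rintro ⟨_, ⟨i, rfl⟩, rfl⟩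
        obtain ⟨j, rfl⟩ := hsurj i
        exact ⟨j, by rw [(hQ j).1]⟩

/-- Uniqueness: cycles are periodic orbits, and two of them in one component have meeting forward
orbits, so they coincide. -/
theorem isSaturatedForest_of_function [Finite V] : Γ.IsSaturatedForest τ := by
  intro K
  induction K using SimpleGraph.ConnectedComponent.ind with | h x => ?_
  obtain ⟨γ, hγ, hc, hK⟩ := exists_isCycle_in_component hf x
  refine ⟨γ, ⟨hγ, hc, hK⟩, ?_⟩
  rintro γ' ⟨hγ', hc', hK'⟩
  obtain ⟨Z, ⟨z, hz⟩, hZ1, ⟨p, hp, hZp⟩, hZγ⟩ := hc.exists_invariant hf hγ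
  obtain ⟨Z', ⟨z', hz'⟩, hZ1', ⟨p', hp', hZp'⟩, hZγ'⟩ := hc'.exists_invariant hf hγ'
  have hiter : ∀ {Z : Set V}, (∀ z ∈ Z, f z ∈ Z) → ∀ (m : ℕ), ∀ z ∈ Z, f^[m] z ∈ Z := by
    intro Z hZ m
    induction m with
    | zero => intro z hz; exact hz
    | succ m ih => intro z hz; rw [Function.iterate_succ_apply']; exact hZ _ (ih z hz)
  have hreach : ∀ {γ : Finset E} {Z : Set V}, (∀ e ∈ γ, (Γ.spanningGraph τ).connectedComponentMk
      (Γ.src e) = (Γ.spanningGraph τ).connectedComponentMk x) →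
      (∀ e, e ∈ γ ↔ ∃ z ∈ Z, (φ z : E) = e) → ∀ z ∈ Z, (Γ.spanningGraph τ).Reachable x z := by
    intro γ Z hγ hZγ z hz
    have h1 := SimpleGraph.ConnectedComponent.eq.1 (hγ _ ((hZγ _).2 ⟨z, hz, rfl⟩))
    rcases (hf z).eq_or_eq (joins_src_tgt (φ z : E)) with h | h
    · exact h.1 ▸ h1.symm
    · rw [← h.2] at h1
      exact h1.symm.trans (reachable_iterate hf 1 z).symm
  have hsub : ∀ {Z Z' : Set V} {p : ℕ}, 0 < p → (∀ z ∈ Z, f^[p] z = z) → (∀ z ∈ Z', f z ∈ Z') →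
      ∀ z ∈ Z, ∀ z' ∈ Z', (Γ.spanningGraph τ).Reachable z z' → z ∈ Z' := by
    intro Z Z' p hp hZp hZ' z hz z' hz' hzz'
    obtain ⟨m, k, hmk⟩ := exists_iterate_eq_of_reachable hf hzz'
    have h1 : f^[p * m] z = z := (Function.IsPeriodicPt.mul_const (hZp z hz) m : _)
    -- A multiple of the period that is at least m brings the orbit of z back to z after it has
    -- entered Z'.
    have h2 : p * m = (p * m - m) + m :=
      (Nat.sub_add_cancel (Nat.le_mul_of_pos_left m hp)).symm
    rw [h2, Function.iterate_add_apply, hmk, ← Function.iterate_add_apply] at h1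
    rw [← h1]
    exact hiter hZ' _ z' hz'
  have hr := hreach hK hZγ
  have hr' := hreach hK' hZγ'
  have hZZ : Z' = Z := Set.Subset.antisymm
    (fun a ha => hsub hp' hZp' hZ1 a ha z hz ((hr' a ha).symm.trans (hr z hz)))
    (fun a ha => hsub hp hZp hZ1' a ha z' hz' ((hr a ha).symm.trans (hr' z' hz')))
  ext e
  rw [hZγ, hZγ', hZZ]

end FunctionalGraph

/-! ### Nonvanishing minors and the forest expansion -/

section Weights

variable {V E : Type*} [DecidableEq V] {Γ : OrientedMultigraph V E} {τ γ : Finset E}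

theorem Joins.incidence_apply {R : Type*} [Ring R] {e : E} {u v : V} (h : Γ.Joins e u v) (x : V) :
    Γ.incidence R x e = (if u = x then 1 else 0) + (if v = x then 1 else 0) := by
  rcases h with ⟨rfl, rfl⟩ | ⟨rfl, rfl⟩
  · exact add_comm _ _
  · rfl

theorem incidence_map_intCast {R : Type*} [Ring R] :
    Γ.incidence R = (Γ.incidence ℤ).map (Int.cast : ℤ → R) := by
  ext v e
  simp [incidence]

variable [Fintype V]

/-- A nonzero Leibniz term matches vertices bijectively with incident edges; f takes a vertex to the
other end of its edge. -/
theorem exists_function_of_det_ne_zero {φ : V ≃ τ}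
    (h : ((Γ.incidence ℤ).submatrix id (fun u => (φ u : E))).det ≠ 0) :
    ∃ (ψ : V ≃ τ) (f : V → V), ∀ u, Γ.Joins (ψ u) u (f u) := by
  rw [Matrix.det_apply] at h
  obtain ⟨σ, -, hσ⟩ := Finset.exists_ne_zero_of_sum_ne_zero h
  have h1 : ∀ u, Γ.incidence ℤ (σ u) (φ u) ≠ 0 := fun u h0 =>
    hσ (by rw [Finset.prod_eq_zero (Finset.mem_univ u) h0, smul_zero])
  have h2 : ∀ u, ∃ v, Γ.Joins (φ (σ.symm u)) u v := fun u => by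
    have h3 := h1 (σ.symm u)
    rw [σ.apply_symm_apply] at h3
    by_contra! h4
    have h5 : Γ.src (φ (σ.symm u)) ≠ u := fun h => h4 (Γ.tgt (φ (σ.symm u))) (Or.inl ⟨h, rfl⟩)
    have h6 : Γ.tgt (φ (σ.symm u)) ≠ u := fun h => h4 (Γ.src (φ (σ.symm u))) (Or.inr ⟨rfl, h⟩)
    exact h3 (by simp [incidence, h5, h6])
  choose f hf using h2
  exact ⟨σ.symm.trans φ, f, hf⟩

/-- On an even cycle, alternating signs on the edges cancel at every vertex and give a nonzero
kernel vector. -/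
theorem IsCycle.odd_of_det_ne_zero {φ : V ≃ τ}
    (h : ((Γ.incidence ℤ).submatrix id (fun u => (φ u : E))).det ≠ 0) (hγ : γ ⊆ τ)
    (hc : Γ.IsCycle γ) : Odd γ.card := by
  classical
  obtain ⟨n, v, g, hv, hg, hj, hr⟩ := hc
  rw [card_of_coe_eq_range hg hr]
  by_contra heven
  rw [Nat.not_odd_iff_even] at heven
  have hgτ : ∀ i, g i ∈ τ := fun i => hγ (by rw [← Finset.mem_coe, hr]; exact mem_range_self _)
  let s : Fin (n + 1) → ℤ := fun i => (-1) ^ (i : ℕ)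
  -- The sign rule also holds across the wraparound from n to 0, because n is odd.
  have hs : ∀ i, s (i + 1) = -s i := fun i => by
    by_cases hi : i = Fin.last n
    · subst hi
      have : Odd n := by rw [Nat.even_add_one] at heven; exact Nat.not_even_iff_odd.1 heven
      simp [s, this.neg_one_pow]
    · have : ((i + 1 : Fin (n + 1)) : ℕ) = i + 1 := Fin.val_add_one_of_lt (Fin.lt_last_iff_ne_last.2 hi)
      simp [s, this, pow_succ]
  let z : V → ℤ := fun u => ∑ i, if φ.symm ⟨g i, hgτ i⟩ = u then s i else 0
  refine h (Matrix.exists_mulVec_eq_zero_iff.1 ⟨z, fun h0 => ?_, ?_⟩)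
  · have h1 := congrFun h0 (φ.symm ⟨g 0, hgτ 0⟩)
    simp only [z, EmbeddingLike.apply_eq_iff_eq, Subtype.mk.injEq, hg.eq_iff, Finset.sum_ite_eq',
      Finset.mem_univ, if_true] at h1
    simp [s] at h1
  · ext x
    have h1 : ∀ u, Γ.incidence ℤ x (φ u) * z u =
        ∑ i, if φ.symm ⟨g i, hgτ i⟩ = u then Γ.incidence ℤ x (φ u) * s i else 0 := fun u => by
      simp only [z, Finset.mul_sum, mul_ite, mul_zero]
    simp only [Matrix.mulVec, dotProduct, Matrix.submatrix_apply, id, h1, Pi.zero_apply]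
    rw [Finset.sum_comm]
    simp only [Finset.sum_ite_eq, Finset.mem_univ, if_true, Equiv.apply_symm_apply]
    have h2 : ∀ i, Γ.incidence ℤ x (g i) * s i =
        (if v i = x then s i else 0) - (if v (i + 1) = x then s (i + 1) else 0) := fun i => by
      rw [(hj i).incidence_apply, hs, add_mul, sub_eq_add_neg]
      congr 1
      · simp
      · split_ifs <;> simp
    simp only [h2, Finset.sum_sub_distrib]
    rw [sub_eq_zero]
    exact (Equiv.sum_comp (Equiv.addRight (1 : Fin (n + 1)))
      (fun i => if v i = x then s i else 0)).symm

theorem isOddSaturatedForest_of_det_ne_zero {φ : V ≃ τ}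
    (h : ((Γ.incidence ℤ).submatrix id (fun u => (φ u : E))).det ≠ 0) :
    Γ.IsOddSaturatedForest τ := by
  obtain ⟨ψ, f, hf⟩ := exists_function_of_det_ne_zero h
  exact ⟨isSaturatedForest_of_function hf, fun γ hγ hc => hc.odd_of_det_ne_zero h hγ⟩

variable [DecidableEq E]

open scoped Classical in
/-- The minor of the unoriented incidence structure selected by a set of edges. -/
theorem det_incidence_blocks (τ : Finset E) :
    (Matrix.fromBlocks 0 ((-Γ.incidence ℂ).submatrix id ((↑) : τ → E))
      ((-(Γ.incidence ℂ).transpose).submatrix ((↑) : τ → E) id) 0).det =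
      (-1) ^ Fintype.card V *
        if Γ.IsOddSaturatedForest τ then (4 : ℂ) ^ Γ.numComponents τ else 0 := by
  have hsq : ∀ φ : V ≃ τ, (Matrix.fromBlocks 0 ((-Γ.incidence ℂ).submatrix id ((↑) : τ → E))
      ((-(Γ.incidence ℂ).transpose).submatrix ((↑) : τ → E) id) 0).det = (-1) ^ Fintype.card V *
        ((((Γ.incidence ℤ).submatrix id (fun u => (φ u : E))).det ^ 2 : ℤ) : ℂ) := fun φ => by
    rw [Matrix.det_fromBlocks_zero_zero _ _ φ]
    congr 1
    have h1 : ((-Γ.incidence ℂ).submatrix id ((↑) : τ → E)).submatrix id φ =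
        -((Γ.incidence ℤ).submatrix id (fun u => (φ u : E))).map (Int.cast : ℤ → ℂ) := by
      rw [incidence_map_intCast]; rfl
    have h2 : ((-(Γ.incidence ℂ).transpose).submatrix ((↑) : τ → E) id).submatrix φ id =
        (-((Γ.incidence ℤ).submatrix id (fun u => (φ u : E))).map (Int.cast : ℤ → ℂ)).transpose := by
      rw [incidence_map_intCast]; rfl
    rw [h1, h2, Matrix.det_transpose, Matrix.det_neg, ← Int.cast_det]
    push_cast
    rw [mul_mul_mul_comm, ← mul_pow]
    simp [sq]
  split_ifs with h
  · have hcard : Fintype.card V = Fintype.card τ := by rw [Fintype.card_coe, h.card_eq]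
    obtain ⟨φ⟩ := Fintype.card_eq.1 hcard
    rw [hsq φ, ← Int.natAbs_sq, h.natAbs_det φ]
    push_cast
    rw [← pow_mul, mul_comm (Γ.numComponents τ), pow_mul]
    norm_num
  · rw [mul_zero]
    by_contra h0
    obtain ⟨φ⟩ := Fintype.card_eq.1 (Matrix.card_eq_of_det_fromBlocks_zero_zero_ne_zero _ _ h0)
    rw [hsq φ] at h0
    refine h (isOddSaturatedForest_of_det_ne_zero (φ := φ) fun h1 => h0 ?_)
    rw [h1]; simp

variable [Fintype E]

open scoped Classical in
/-- The expansion of the limiting determinant over odd saturated forests. -/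
theorem det_incidence_diagonal (Γ : OrientedMultigraph V E) (d : E → ℂ) :
    (Matrix.fromBlocks 0 (-Γ.incidence ℂ) (-(Γ.incidence ℂ).transpose) (Matrix.diagonal d)).det =
      (-1) ^ Fintype.card V * ∑ τ : Finset E with Γ.IsOddSaturatedForest τ,
        (4 : ℂ) ^ Γ.numComponents τ * ∏ e with e ∉ τ, d e := by
  rw [Matrix.det_fromBlocks_zero_diagonal, Finset.mul_sum, Finset.sum_filter]
  refine Finset.sum_congr rfl fun τ _ => ?_
  rw [det_incidence_blocks]
  split_ifs
  · ring
  · simp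

end Weights

end OrientedMultigraph

/-! ### The asymptotic formula -/

/-- The arbitrary filter encodes uniformity: one may index by pairs (k, λ) with λ in the disc of
radius K, along the filter k → ∞. -/
theorem mainTheorem2 {V E : Type*} [Fintype V] [Fintype E] [DecidableEq V] [DecidableEq E]
    (Γ : OrientedMultigraph V E) (q : E → ℝ → ℂ) (hq : ∀ e, IntegrableOn (q e) (Ioo 0 1))
    {ι : Type*} (l : Filter ι) (k : ι → ℕ) (hk : Tendsto k l atTop)
    (lam : ι → ℂ)
    (hlam : (fun i => lam i - ((2 * (k i : ℂ) + 1) ^ 2 * (Real.pi : ℂ) ^ 2)) =O[l]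
      fun _ => (1 : ℝ)) :
    (fun i => Γ.spectralDet hq (lam i)
        - (-1 : ℂ) ^ Fintype.card V * Γ.forestSum hq (lam i)) =o[l]
      fun i => ‖lam i‖ ^ (-(((Fintype.card E : ℝ) - (Fintype.card V : ℝ) + 1) / 2)) := by
  classical
  set ε : ι → ℝ := fun i => ‖lam i‖ ^ (-(1 / 2) : ℝ) with hε
  have hpos : ∀ᶠ i in l, 0 < ‖lam i‖ := (norm_tendsto_atTop hk hlam).eventually_gt_atTop 0
  have hε0 : ∀ᶠ i in l, 0 < ε i := hpos.mono fun i hi => Real.rpow_pos_of_pos hi _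
  have hεlim : Tendsto ε l (𝓝 0) :=
    (tendsto_rpow_neg_atTop (by norm_num : (0 : ℝ) < 1 / 2)).comp (norm_tendsto_atTop hk hlam)
  have hε1 : ε =O[l] fun _ => (1 : ℝ) := hεlim.isBigO_one ℝ
  have hinv := odd_mul_pi_inv_isBigO hk hlam
  -- X is the limiting matrix and Y the scaled spectral matrix. Their last blocks agree exactly, so
  -- no expansion of s is needed.
  let d : ι → E → ℂ := fun i e => ((ε i)⁻¹ : ℂ) * (complexSqrt (lam i) * solS (hq e) 1 (lam i))
  let X : ι → Matrix (V ⊕ E) (V ⊕ E) ℂ := fun i => Matrix.fromBlocks 0 (-Γ.incidence ℂ)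
    (-(Γ.incidence ℂ).transpose) (Matrix.diagonal (d i))
  let Y : ι → Matrix (V ⊕ E) (V ⊕ E) ℂ := fun i => Matrix.fromBlocks
    ((ε i : ℂ) • Γ.blockA hq (lam i)) (Γ.blockB hq (lam i)) (Γ.blockC hq (lam i))
    (((ε i)⁻¹ : ℂ) • OrientedMultigraph.blockD hq (lam i))
  have hd : ∀ e, (fun i => d i e) =O[l] fun _ => (1 : ℝ) := fun e => by
    have h1 : (fun i => ((ε i)⁻¹ : ℂ)) =O[l] fun i => (ε i)⁻¹ :=
      IsBigO.of_norm_left ((isBigO_refl (fun i => (ε i)⁻¹) l).norm_left.congr_left fun i => by simp)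
    refine (h1.mul (complexSqrt_mul_solS_isBigO (hq e) hk hlam)).congr' EventuallyEq.rfl ?_
    filter_upwards [hε0] with i hi
    exact inv_mul_cancel₀ hi.ne'
  have hX : ∀ a b, (fun i => X i a b) =O[l] fun _ => (1 : ℝ) := by
    rintro (a | a) (b | b)
    · refine (isBigO_zero (E' := ℂ) (fun _ => (1 : ℝ)) l).congr_left fun i => ?_
      simp [X]
    · simpa [X] using isBigO_const_const (-Γ.incidence ℂ a b) (one_ne_zero (α := ℝ)) l
    · simpa [X] using isBigO_const_const (-Γ.incidence ℂ b a) (one_ne_zero (α := ℝ)) l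
    · by_cases hab : a = b
      · subst hab; simpa [X] using hd a
      · refine (isBigO_zero (E' := ℂ) (fun _ => (1 : ℝ)) l).congr_left fun i => ?_
        simp [X, hab]
  have hC : ∀ e, (fun i => solC (hq e) 1 (lam i) + 1) =o[l] ε := fun e =>
    (solC_add_one_isLittleO (hq e) hk hlam).trans_isBigO hinv
  have hS : ∀ e, (fun i => solS' (hq e) 1 (lam i) + 1) =o[l] ε := fun e =>
    (solS'_add_one_isLittleO (hq e) hk hlam).trans_isBigO hinv
  have hXY : ∀ a b, (fun i => Y i a b - X i a b) =o[l] ε := by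
    rintro (a | a) (b | b)
    · have h1 : (fun i => Γ.blockA hq (lam i) a b) =o[l] fun _ => (1 : ℝ) := by
        simp only [OrientedMultigraph.blockA, Finset.mul_sum]
        exact IsLittleO.fun_sum fun e _ => complexSqrt_inv_mul_solC'_isLittleO (hq e) hk hlam
      have h2 : (fun i => (ε i : ℂ)) =O[l] ε :=
        IsBigO.of_norm_left ((isBigO_refl ε l).norm_left.congr_left fun i => by simp)
      simpa [X, Y] using h2.mul_isLittleO h1
    · by_cases h : Γ.tgt b = a
      · refine (hS b).congr_left fun i => ?_
        simp only [X, Y, Matrix.fromBlocks_apply₁₂, OrientedMultigraph.blockB, Matrix.neg_apply,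
          OrientedMultigraph.incidence, h, if_true]
        split_ifs <;> ring
      · refine (isLittleO_zero (E' := ℂ) ε l).congr_left fun i => ?_
        simp only [X, Y, Matrix.fromBlocks_apply₁₂, OrientedMultigraph.blockB, Matrix.neg_apply,
          OrientedMultigraph.incidence, h, if_false]
        split_ifs <;> ring
    · by_cases h : Γ.src a = b
      · refine (hC a).congr_left fun i => ?_
        simp only [X, Y, Matrix.fromBlocks_apply₂₁, OrientedMultigraph.blockC, Matrix.neg_apply,
          Matrix.transpose_apply, OrientedMultigraph.incidence, h, if_true]
        split_ifs <;> ring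
      · refine (isLittleO_zero (E' := ℂ) ε l).congr_left fun i => ?_
        simp only [X, Y, Matrix.fromBlocks_apply₂₁, OrientedMultigraph.blockC, Matrix.neg_apply,
          Matrix.transpose_apply, OrientedMultigraph.incidence, h, if_false]
        split_ifs <;> ring
    · refine (isLittleO_zero (E' := ℂ) ε l).congr_left fun i => ?_
      by_cases hab : a = b
      · subst hab; simp [X, Y, OrientedMultigraph.blockD, d]
      · simp [X, Y, OrientedMultigraph.blockD, hab]
  have hdet := det_sub_det_isLittleO hX hXY hε1
  -- The factor undoing the scaling is kept as two natural powers, since |V| may exceed |E|.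
  have hscale : (fun i => (ε i) ^ Fintype.card E * ((ε i)⁻¹) ^ Fintype.card V) =O[l]
      fun i => (ε i) ^ Fintype.card E * ((ε i)⁻¹) ^ Fintype.card V := isBigO_refl _ _
  have hscale' : (fun i => (((ε i) ^ Fintype.card E * ((ε i)⁻¹) ^ Fintype.card V : ℝ) : ℂ)) =O[l]
      fun i => (ε i) ^ Fintype.card E * ((ε i)⁻¹) ^ Fintype.card V :=
    IsBigO.of_norm_left (hscale.norm_left.congr_left fun i => (Complex.norm_real _).symm)
  refine (hscale'.mul_isLittleO hdet).congr' ?_ ?_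
  · filter_upwards [hε0] with i hi
    have hne : (ε i : ℂ) ≠ 0 := by exact_mod_cast hi.ne'
    have hY : (Y i).det = (ε i : ℂ) ^ Fintype.card V * ((ε i)⁻¹ : ℂ) ^ Fintype.card E *
        Γ.spectralDet hq (lam i) :=
      Matrix.det_fromBlocks_smul _ _ _ _ (mul_inv_cancel₀ hne)
    have hXd : (X i).det = (-1) ^ Fintype.card V * ((ε i : ℂ) ^ Fintype.card V *
        ((ε i)⁻¹ : ℂ) ^ Fintype.card E * Γ.forestSum hq (lam i)) := by
      rw [show (X i).det = _ from Γ.det_incidence_diagonal (d i), OrientedMultigraph.forestSum]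
      congr 1
      rw [Finset.mul_sum]
      refine Finset.sum_congr (by congr!) fun τ hτ => ?_
      have hτ' : Γ.IsOddSaturatedForest τ := (Finset.mem_filter.1 hτ).2
      -- Exactly |E| - |V| edges lie outside τ, so the scaling factor distributes as one ε⁻¹ per
      -- factor of the product.
      have hcard : (Finset.univ.filter (· ∉ τ)).card + Fintype.card V = Fintype.card E := by
        rw [← hτ'.card_eq, Finset.filter_notMem_eq_sdiff,
          Finset.card_sdiff_add_card_eq_card (Finset.subset_univ _), Finset.card_univ]
      have hp : (ε i : ℂ) ^ Fintype.card V * ((ε i)⁻¹ : ℂ) ^ Fintype.card E =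
          ((ε i)⁻¹ : ℂ) ^ (Finset.univ.filter (· ∉ τ)).card := by
        rw [← hcard, pow_add, mul_comm, mul_assoc, ← mul_pow, inv_mul_cancel₀ hne, one_pow, mul_one]
      simp only [d]
      rw [Finset.prod_mul_distrib, Finset.prod_const, hp]
      convert! mul_left_comm _ _ _
    rw [hY, hXd]
    push_cast
    simp only [inv_pow]
    field_simp
  · filter_upwards [hpos] with i hi
    have h1 : (ε i)⁻¹ = ‖lam i‖ ^ (1 / 2 : ℝ) := by rw [hε, ← Real.rpow_neg hi.le]; norm_num
    rw [h1, hε]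
    simp only
    rw [← Real.rpow_natCast, ← Real.rpow_natCast, ← Real.rpow_mul hi.le, ← Real.rpow_mul hi.le,
      ← Real.rpow_add hi, ← Real.rpow_add hi]
    congr 1
    ring
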